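/- Let $\mathcal{A}$ and $\mathcal{B}$ be abelian categories with enough projective objects, and let $F\colon\mathcal{A}\to\mathcal{B}$ and $G\colon\mathcal{B}\to\mathcal{A}$ be faithful additive functors forming a Frobenius pair; that is, there are autoequivalences $\alpha$ of $\mathcal{A}$ and $\beta$ of $\mathcal{B}$ such that both $(F,G)$ and $(G,\beta F\alpha)$ are adjoint pairs. Let $\eta\colon \mathrm{Id}_{\mathcal{A}}\to GF$ and $\varepsilon\colon FG\to \mathrm{Id}_{\mathcal{B}}$ be the unit and the counit of the adjoint pair $(F,G)$. An object $M$ of $\mathcal{A}$ is Gorenstein projective if it is isomorphic to $Z^0(P^\bullet)$ for an acyclic complex $P^\bullet$ of projective objects that remains acyclic after applying $\mathrm{Hom}_{\mathcal{A}}(-,Q)$ for every projective $Q$; let $\mathcal{GP}(\mathcal{A})$ be the full subcategory of such objects. An object $X$ has finite Gorenstein projective dimension if for some $n\ge 0$ there is an exact sequence $0\to M^{-n}\to\cdots\to M^0\to X\to 0$ with all $M^{-i}\in\mathcal{GP}(\mathcal{A})$. Let $\underline{\mathcal{GP}}(\mathcal{A})$ be the stable category, the quotient of $\mathcal{GP}(\mathcal{A})$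 by the morphisms factoring through projective objects. Let $\mathbf{D}_{\rm sg}(\mathcal{A})=\mathbf{D}^b(\mathcal{A})/\mathbf{K}^b(\mathcal{P}(\mathcal{A}))$ be the singularity category and $\mathbf{D}_{\rm def}(\mathcal{A})=\mathbf{D}^b(\mathcal{A})/\mathbf{D}^b(\mathcal{A})_{\rm fGd}$ the Gorenstein defect category (Verdier quotients), where $\mathcal{P}(\mathcal{A})$ is the full subcategory of projective objects and $\mathbf{D}^b(\mathcal{A})_{\rm fGd}$ consists of the objects of $\mathbf{D}^b(\mathcal{A})$ isomorphic to a bounded complex of Gorenstein projective objects. The functors $F$ and $G$ are exact and preserve projective and Gorenstein projective objects, so the adjoint pair $(F,G)$ induces adjoint pairs on these three categories, denoted by the same letters. Then the following hold. (1) The induced adjoint pair $F\colon \underline{\mathcal{GP}}(\mathcal{A})\rightleftarrows \underline{\mathcal{GP}}(\mathcal{B})\colon G$ yields mutually inverse equivalences if and only if $\mathrm{Cok}(\eta_X)$ has projective dimension at most one for every $X\in\mathcal{GP}(\mathcal{A})$ and $\mathrm{Ker}(\varepsilon_Y)$ is projective for every $Y\in\mathcal{GP}(\mathcal{B})$. (2)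 The induced adjoint pair $F\colon \mathbf{D}_{\rm sg}(\mathcal{A})\rightleftarrows \mathbf{D}_{\rm sg}(\mathcal{B})\colon G$ yields mutually inverse equivalences if and only if $\mathrm{Cok}(\eta_X)$ and $\mathrm{Ker}(\varepsilon_Y)$ have finite projective dimension for all $X\in\mathcal{A}$ and $Y\in\mathcal{B}$. (3) The induced adjoint pair $F\colon \mathbf{D}_{\rm def}(\mathcal{A})\rightleftarrows \mathbf{D}_{\rm def}(\mathcal{B})\colon G$ yields mutually inverse equivalences if and only if $\mathrm{Cok}(\eta_X)$ and $\mathrm{Ker}(\varepsilon_Y)$ have finite Gorenstein projective dimension for all $X\in\mathcal{A}$ and $Y\in\mathcal{B}$. Here an adjoint pair yields mutually inverse equivalences if its unit and its counit are isomorphisms. -/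

import Mathlib

open CategoryTheory CategoryTheory.Limits

universe w w' v v' u u'

noncomputable section

namespace FrobGor

/-! ### Frobenius pairs -/

/-- The data exhibiting `(F, G)` as a Frobenius pair of type `(α, β)`, where `α` and `β` are
autoequivalences: both `(F, G)` and `(G, βFα)` are adjoint pairs. -/
structure FrobeniusPair {A : Type u} [Category.{v} A] {B : Type u'} [Category.{v'} B]
    (F : A ⥤ B) (G : B ⥤ A) where
  /-- the autoequivalence of the source -/
  α : A ≌ A
  /-- the autoequivalence of the target -/
  β : B ≌ B
  /-- the adjunction between `F` and `G`, with unit `η` and counit `ε` -/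
  adj : F ⊣ G
  /-- the adjunction between `G` and `βFα` -/
  adj' : G ⊣ α.functor ⋙ F ⋙ β.functor

section Objects

variable {A : Type u} [Category.{v} A] [Abelian A]

/-! ### Gorenstein projective objects -/

/-- A totally acyclic complex: an acyclic complex of projective objects which remains acyclic
after applying `Hom(-, Q)` for every projective object `Q`. -/
structure IsTotallyAcyclic (P : CochainComplex A ℤ) : Prop where
  projective (i : ℤ) : Projective (P.X i)
  acyclic : P.Acyclic
  /-- `Hom(P^{k}, Q) ⟶ Hom(P^{j}, Q) ⟶ Hom(P^{i}, Q)` is exact, for `i + 1 = j`, `j + 1 = k`. -/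
  hom_exact (Q : A) (_ : Projective Q) (i j k : ℤ) (_ : i + 1 = j) (_ : j + 1 = k)
    (f : P.X j ⟶ Q) (_ : P.d i j ≫ f = 0) : ∃ g : P.X k ⟶ Q, P.d j k ≫ g = f

variable (A) in
/-- `GP(A)`: the objects isomorphic to the zeroth cocycle `Z⁰(P)` of a totally acyclic complex. -/
def gorensteinProjective : ObjectProperty A := fun M =>
  ∃ P : CochainComplex A ℤ, IsTotallyAcyclic P ∧ Nonempty (M ≅ P.cycles 0)

/-- `Gpd X ≤ n`: there is an exact sequence `0 ⟶ Mₙ ⟶ ⋯ ⟶ M₀ ⟶ X ⟶ 0` with all `Mᵢ` Gorenstein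
projective. The sequence is given by its decomposition into short exact sequences. -/
def GpdLE : ℕ → A → Prop
  | 0, X => gorensteinProjective A X
  | n + 1, X => ∃ S : ShortComplex A, S.ShortExact ∧ GpdLE n S.X₁ ∧
      gorensteinProjective A S.X₂ ∧ Nonempty (S.X₃ ≅ X)

/-- The object `X` has finite Gorenstein projective dimension. -/
def HasFiniteGpd (X : A) : Prop := ∃ n : ℕ, GpdLE n X

/-! ### The stable category of Gorenstein projective objects -/

variable (A) in
/-- Two morphisms between Gorenstein projective objects are identified in the stable category
when their difference factors through a projective object. -/
def stableRel : HomRel (gorensteinProjective A).FullSubcategory := fun X Y f g =>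
  ∃ (P : A) (_ : Projective P) (a : X.obj ⟶ P) (b : P ⟶ Y.obj), f.hom - g.hom = a ≫ b

variable (A) in
/-- The stable category of Gorenstein projective objects. -/
abbrev StableGP : Type _ := CategoryTheory.Quotient (stableRel A)

/-! ### The singularity category and the Gorenstein defect category -/

variable [HasDerivedCategory.{w} A]

/-- For a class `𝒞` of objects of `A`, the objects of the bounded derived category `D^b(A)`
which are isomorphic to a bounded complex with all components in `𝒞`. -/
def boundedComplexesOf (𝒞 : ObjectProperty A) : ObjectProperty (DerivedCategory.Bounded A) :=
  fun X => ∃ (K : CochainComplex A ℤ) (a b : ℤ), K.IsStrictlyGE a ∧ K.IsStrictlyLE b ∧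
    (∀ i, 𝒞 (K.X i)) ∧ Nonempty (X.obj ≅ DerivedCategory.Q.obj K)

variable (A) in
/-- `K^b(P(A))`, viewed as a (strictly full) subcategory of `D^b(A)`. -/
abbrev perfect : ObjectProperty (DerivedCategory.Bounded A) :=
  boundedComplexesOf (isProjective A)

variable (A) in
/-- `D^b(A)_fGd`. -/
abbrev fGd : ObjectProperty (DerivedCategory.Bounded A) :=
  boundedComplexesOf (gorensteinProjective A)

/-- The Verdier quotient of `D^b(A)` by the subcategory of complexes isomorphic to a bounded
complex with components in `𝒞`: the localization with respect to the morphisms whose cone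
lies in this subcategory. -/
abbrev BoundedQuotient (𝒞 : ObjectProperty A) : Type _ :=
  (boundedComplexesOf 𝒞).trW.Localization

variable (A) in
/-- The singularity category `D_sg(A) = D^b(A) / K^b(P(A))`. -/
abbrev Dsg : Type _ := BoundedQuotient (isProjective A)

variable (A) in
/-- The Gorenstein defect category `D_def(A) = D^b(A) / D^b(A)_fGd`. -/
abbrev Ddef : Type _ := BoundedQuotient (gorensteinProjective A)

end Objects

section Induced

variable {A : Type u} [Category.{v} A] [Abelian A] {B : Type u'} [Category.{v'} B] [Abelian B]

/-! ### The functors and adjunctions induced on stable categories -/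

/-- The functor `GP(A) ⥤ GP(B)` induced by a functor preserving Gorenstein projectives. -/
def gpMap (F : A ⥤ B)
    (hGP : gorensteinProjective A ≤ (gorensteinProjective B).inverseImage F) :
    (gorensteinProjective A).FullSubcategory ⥤ (gorensteinProjective B).FullSubcategory :=
  (gorensteinProjective B).lift ((gorensteinProjective A).ι ⋙ F) (fun X => hGP _ X.property)

/-- The functor induced on stable categories. -/
def stableMap (F : A ⥤ B) [F.Additive]
    (hGP : gorensteinProjective A ≤ (gorensteinProjective B).inverseImage F)
    (hP : isProjective A ≤ (isProjective B).inverseImage F) : StableGP A ⥤ StableGP B :=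
  CategoryTheory.Quotient.lift _ (gpMap F hGP ⋙ CategoryTheory.Quotient.functor (stableRel B)) (by
    rintro X Y f g ⟨P, hP', a, b, h⟩
    refine CategoryTheory.Quotient.sound _ ⟨F.obj P, hP _ hP', F.map a, F.map b, ?_⟩
    have h' := congrArg F.map h
    rw [F.map_sub, F.map_comp] at h'
    exact h')

variable {F : A ⥤ B} {G : B ⥤ A} [F.Additive] [G.Additive]

/-- The adjunction induced on Gorenstein projective objects. -/
def gpAdj (adj : F ⊣ G)
    (hGP : gorensteinProjective A ≤ (gorensteinProjective B).inverseImage F)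
    (hGP' : gorensteinProjective B ≤ (gorensteinProjective A).inverseImage G) :
    gpMap F hGP ⊣ gpMap G hGP' :=
  adj.restrictFullyFaithful (gorensteinProjective A).fullyFaithfulι
    (gorensteinProjective B).fullyFaithfulι (Iso.refl _) (Iso.refl _)

/-- The adjunction induced on stable categories: its unit and counit are the classes of those
of the given adjunction. -/
def stableAdj (adj : F ⊣ G)
    (hGP : gorensteinProjective A ≤ (gorensteinProjective B).inverseImage F)
    (hP : isProjective A ≤ (isProjective B).inverseImage F)
    (hGP' : gorensteinProjective B ≤ (gorensteinProjective A).inverseImage G)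
    (hP' : isProjective B ≤ (isProjective A).inverseImage G) :
    stableMap F hGP hP ⊣ stableMap G hGP' hP' :=
  Adjunction.mkOfUnitCounit
    { unit := CategoryTheory.Quotient.natTransLift _
        (Functor.whiskerRight (gpAdj adj hGP hGP').unit
          (CategoryTheory.Quotient.functor (stableRel A)))
      counit := CategoryTheory.Quotient.natTransLift _
        (Functor.whiskerRight (gpAdj adj hGP hGP').counit
          (CategoryTheory.Quotient.functor (stableRel B)))
      left_triangle := by
        ext ⟨X⟩
        refine (congrArg (_ ≫ ·) (Category.id_comp _)).trans ?_
        exact congrArg (CategoryTheory.Quotient.functor (stableRel B)).map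
          ((gpAdj adj hGP hGP').left_triangle_components X)
      right_triangle := by
        ext ⟨X⟩
        refine (congrArg (_ ≫ ·) (Category.id_comp _)).trans ?_
        exact congrArg (CategoryTheory.Quotient.functor (stableRel A)).map
          ((gpAdj adj hGP hGP').right_triangle_components X) }

/-! ### The functors and adjunctions induced on quotients of bounded derived categories -/

/-- The adjunction induced on categories of cochain complexes, termwise. -/
def complexAdj (adj : F ⊣ G) :
    F.mapHomologicalComplex (ComplexShape.up ℤ) ⊣ G.mapHomologicalComplex (ComplexShape.up ℤ) :=
  Adjunction.mkOfUnitCounit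
    { unit :=
        { app := fun K =>
            { f := fun i => adj.unit.app (K.X i)
              comm' := fun i j _ => (adj.unit.naturality (K.d i j)).symm }
          naturality := fun K L f => by ext i; exact adj.unit.naturality (f.f i) }
      counit :=
        { app := fun K =>
            { f := fun i => adj.counit.app (K.X i)
              comm' := fun i j _ => (adj.counit.naturality (K.d i j)).symm }
          naturality := fun K L f => by ext i; exact adj.counit.naturality (f.f i) }
      left_triangle := by
        ext K i
        refine (congrArg (_ ≫ ·) (Category.id_comp _)).trans ?_
        exact adj.left_triangle_components (K.X i)
      right_triangle := by
        ext K i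
        refine (congrArg (_ ≫ ·) (Category.id_comp _)).trans ?_
        exact adj.right_triangle_components (K.X i) }

lemma isStrictlyGE_map (F : A ⥤ B) [F.Additive] (K : CochainComplex A ℤ) (a : ℤ)
    (h : K.IsStrictlyGE a) :
    CochainComplex.IsStrictlyGE ((F.mapHomologicalComplex (ComplexShape.up ℤ)).obj K) a := by
  rw [CochainComplex.isStrictlyGE_iff] at h ⊢
  exact fun i hi => F.map_isZero (h i hi)

lemma isStrictlyLE_map (F : A ⥤ B) [F.Additive] (K : CochainComplex A ℤ) (a : ℤ)
    (h : K.IsStrictlyLE a) :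
    CochainComplex.IsStrictlyLE ((F.mapHomologicalComplex (ComplexShape.up ℤ)).obj K) a := by
  rw [CochainComplex.isStrictlyLE_iff] at h ⊢
  exact fun i hi => F.map_isZero (h i hi)

variable [HasDerivedCategory.{w} A] [HasDerivedCategory.{w'} B]

section

variable [PreservesFiniteLimits F] [PreservesFiniteColimits F]
  [PreservesFiniteLimits G] [PreservesFiniteColimits G]

/-- The adjunction induced on derived categories by an adjunction between exact functors. -/
def derivedAdj (adj : F ⊣ G) : F.mapDerivedCategory ⊣ G.mapDerivedCategory :=
  letI : CatCommSq (F.mapHomologicalComplex (ComplexShape.up ℤ)) DerivedCategory.Q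
      DerivedCategory.Q F.mapDerivedCategory := ⟨F.mapDerivedCategoryFactors.symm⟩
  letI : CatCommSq (G.mapHomologicalComplex (ComplexShape.up ℤ)) DerivedCategory.Q
      DerivedCategory.Q G.mapDerivedCategory := ⟨G.mapDerivedCategoryFactors.symm⟩
  (complexAdj adj).localization
    DerivedCategory.Q (HomologicalComplex.quasiIso A (ComplexShape.up ℤ))
    DerivedCategory.Q (HomologicalComplex.quasiIso B (ComplexShape.up ℤ))
    F.mapDerivedCategory G.mapDerivedCategory

end

section

variable (F) [PreservesFiniteLimits F] [PreservesFiniteColimits F]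

lemma bounded_mapDerivedCategory (X : DerivedCategory A)
    (hX : (DerivedCategory.TStructure.t : Triangulated.TStructure (DerivedCategory A)).bounded X) :
    (DerivedCategory.TStructure.t : Triangulated.TStructure (DerivedCategory B)).bounded
      (F.mapDerivedCategory.obj X) := by
  obtain ⟨⟨a, ha⟩, ⟨b, hb⟩⟩ := hX
  obtain ⟨K, hK, hK', ⟨e⟩⟩ := DerivedCategory.exists_iso_Q_obj_of_isGE_of_isLE X a b
  have h₁ := isStrictlyGE_map F K a hK
  have h₂ := isStrictlyLE_map F K b hK'
  have e' : DerivedCategory.Q.obj ((F.mapHomologicalComplex (ComplexShape.up ℤ)).obj K) ≅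
      F.mapDerivedCategory.obj X :=
    (F.mapDerivedCategory.mapIso e ≪≫ F.mapDerivedCategoryFactors.app K).symm
  exact ⟨⟨a, DerivedCategory.TStructure.t.isGE_of_iso e' a⟩,
    ⟨b, DerivedCategory.TStructure.t.isLE_of_iso e' b⟩⟩

/-- The functor induced on bounded derived categories by an exact functor. -/
def boundedMap : DerivedCategory.Bounded A ⥤ DerivedCategory.Bounded B :=
  DerivedCategory.TStructure.t.bounded.lift (DerivedCategory.Bounded.ι ⋙ F.mapDerivedCategory)
    (fun X => bounded_mapDerivedCategory F _ X.property)

lemma boundedMap_mem {𝒞 : ObjectProperty A} {𝒟 : ObjectProperty B}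
    (h : 𝒞 ≤ 𝒟.inverseImage F) (X : DerivedCategory.Bounded A)
    (hX : boundedComplexesOf 𝒞 X) : boundedComplexesOf 𝒟 ((boundedMap F).obj X) := by
  obtain ⟨K, a, b, ha, hb, hK, ⟨e⟩⟩ := hX
  exact ⟨(F.mapHomologicalComplex (ComplexShape.up ℤ)).obj K, a, b, isStrictlyGE_map F K a ha,
    isStrictlyLE_map F K b hb, fun i => h _ (hK i),
    ⟨F.mapDerivedCategory.mapIso e ≪≫ F.mapDerivedCategoryFactors.app K⟩⟩

instance : (boundedMap F).CommShift ℤ := by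
  dsimp only [boundedMap]
  infer_instance

instance : (boundedMap F).IsTriangulated := by
  dsimp only [boundedMap]
  infer_instance

lemma boundedMap_trW {𝒞 : ObjectProperty A} {𝒟 : ObjectProperty B}
    (h : 𝒞 ≤ 𝒟.inverseImage F) :
    (boundedComplexesOf 𝒞).trW ≤ (boundedComplexesOf 𝒟).trW.inverseImage (boundedMap F) := by
  rintro X Y f ⟨Z, g, k, hT, hZ⟩
  exact ObjectProperty.trW.mk _ ((boundedMap F).map_distinguished _ hT)
    (boundedMap_mem F h _ hZ)

/-- The functor induced on quotients of bounded derived categories by an exact functor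
which sends the class `𝒞` into the class `𝒟`. -/
def quotientMap {𝒞 : ObjectProperty A} {𝒟 : ObjectProperty B}
    (h : 𝒞 ≤ 𝒟.inverseImage F) : BoundedQuotient 𝒞 ⥤ BoundedQuotient 𝒟 :=
  Localization.lift (W := (boundedComplexesOf 𝒞).trW)
    (boundedMap F ⋙ (boundedComplexesOf 𝒟).trW.Q)
    (fun _ _ f hf => Localization.inverts (boundedComplexesOf 𝒟).trW.Q (boundedComplexesOf 𝒟).trW _
      (boundedMap_trW F h f hf))
    (boundedComplexesOf 𝒞).trW.Q

/-- The functor induced on the quotients is compatible with the quotient functors. -/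
def quotientMapFactors {𝒞 : ObjectProperty A} {𝒟 : ObjectProperty B}
    (h : 𝒞 ≤ 𝒟.inverseImage F) :
    boundedMap F ⋙ (boundedComplexesOf 𝒟).trW.Q ≅
      (boundedComplexesOf 𝒞).trW.Q ⋙ quotientMap F h :=
  (Localization.fac _ _ _).symm

end

variable [PreservesFiniteLimits F] [PreservesFiniteColimits F]
  [PreservesFiniteLimits G] [PreservesFiniteColimits G]

/-- The adjunction induced on bounded derived categories. -/
def boundedAdj (adj : F ⊣ G) : boundedMap F ⊣ boundedMap G :=
  (derivedAdj adj).restrictFullyFaithful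
    (DerivedCategory.TStructure.t : Triangulated.TStructure
      (DerivedCategory A)).bounded.fullyFaithfulι
    (DerivedCategory.TStructure.t : Triangulated.TStructure
      (DerivedCategory B)).bounded.fullyFaithfulι (Iso.refl _) (Iso.refl _)

/-- The adjunction induced on quotients of bounded derived categories. -/
def quotientAdj (adj : F ⊣ G) {𝒞 : ObjectProperty A} {𝒟 : ObjectProperty B}
    (h : 𝒞 ≤ 𝒟.inverseImage F) (h' : 𝒟 ≤ 𝒞.inverseImage G) :
    quotientMap F h ⊣ quotientMap G h' :=
  letI : CatCommSq (boundedMap F) (boundedComplexesOf 𝒞).trW.Q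
      (boundedComplexesOf 𝒟).trW.Q (quotientMap F h) := ⟨quotientMapFactors F h⟩
  letI : CatCommSq (boundedMap G) (boundedComplexesOf 𝒟).trW.Q
      (boundedComplexesOf 𝒞).trW.Q (quotientMap G h') := ⟨quotientMapFactors G h'⟩
  (boundedAdj adj).localization
    (boundedComplexesOf 𝒞).trW.Q (boundedComplexesOf 𝒞).trW
    (boundedComplexesOf 𝒟).trW.Q (boundedComplexesOf 𝒟).trW _ _

end Induced

/-- An adjoint pair yields mutually inverse equivalences when its unit and its counit are
isomorphisms. -/
def YieldsEquivalences {C : Type*} [Category* C] {D : Type*} [Category* D]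
    {L : C ⥤ D} {R : D ⥤ C} (adj : L ⊣ R) : Prop :=
  IsIso adj.unit ∧ IsIso adj.counit

namespace FrobeniusPair

/-! ### Frobenius pairs between abelian categories -/

section

variable {A : Type u} [Category.{v} A] {B : Type u'} [Category.{v'} B]
  {F : A ⥤ B} {G : B ⥤ A} (h : FrobeniusPair F G)

/-- `F` is isomorphic to `β⁻¹ (βFα) α⁻¹`. -/
def isoConj : h.α.inverse ⋙ (h.α.functor ⋙ F ⋙ h.β.functor) ⋙ h.β.inverse ≅ F :=
  Functor.isoWhiskerLeft (h.α.inverse ⋙ h.α.functor ⋙ F) h.β.unitIso.symm ≪≫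
    Functor.isoWhiskerRight h.α.counitIso F

lemma isRightAdjoint_left (h : FrobeniusPair F G) : F.IsRightAdjoint := by
  have := h.adj'.isRightAdjoint
  exact Functor.isRightAdjoint_of_iso h.isoConj

lemma preservesFiniteLimits_left (h : FrobeniusPair F G) : PreservesFiniteLimits F := by
  have := h.isRightAdjoint_left
  infer_instance

lemma preservesFiniteColimits_left (h : FrobeniusPair F G) : PreservesFiniteColimits F := by
  have := h.adj.isLeftAdjoint
  infer_instance

lemma preservesFiniteLimits_right (h : FrobeniusPair F G) : PreservesFiniteLimits G := by
  have := h.adj.isRightAdjoint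
  infer_instance

lemma preservesFiniteColimits_right (h : FrobeniusPair F G) : PreservesFiniteColimits G := by
  have := h.adj'.isLeftAdjoint
  infer_instance

lemma projective_left (h : FrobeniusPair F G) :
    isProjective A ≤ (isProjective B).inverseImage F := by
  have := h.adj'.isLeftAdjoint
  exact fun P hP => h.adj.map_projective P hP

lemma projective_right (h : FrobeniusPair F G) :
    isProjective B ≤ (isProjective A).inverseImage G := by
  have := h.adj.isLeftAdjoint
  exact fun P hP => h.adj'.map_projective P hP

end

section

variable {A : Type u} [Category.{v} A] [Abelian A] {B : Type u'} [Category.{v'} B] [Abelian B]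

lemma gorensteinProjective_le_inverseImage {F : A ⥤ B} {G : B ⥤ A} [F.Additive]
    [PreservesFiniteLimits F] [PreservesFiniteColimits F] (adj : F ⊣ G)
    (hF : isProjective A ≤ (isProjective B).inverseImage F)
    (hG : isProjective B ≤ (isProjective A).inverseImage G) :
    gorensteinProjective A ≤ (gorensteinProjective B).inverseImage F := by
  rintro M ⟨P, hP, ⟨e⟩⟩
  refine ⟨(F.mapHomologicalComplex _).obj P, ⟨fun i => hF _ (hP.projective i), fun i => ?_, ?_⟩,
    ⟨F.mapIso e ≪≫ ((P.sc 0).mapCyclesIso F).symm⟩⟩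
  · exact (hP.acyclic i).map F
  · intro Q hQ i j k hij hjk (f : F.obj (P.X j) ⟶ Q) (hf : F.map (P.d i j) ≫ f = 0)
    have hG' : P.d i j ≫ adj.homEquiv _ _ f = 0 := by
      rw [← adj.homEquiv_naturality_left, hf]
      have := adj.isRightAdjoint
      simp [Adjunction.homEquiv_unit]
    obtain ⟨g, hg⟩ := hP.hom_exact _ (hG _ hQ) i j k hij hjk _ hG'
    refine ⟨(adj.homEquiv _ _).symm g, ?_⟩
    apply (adj.homEquiv _ _).injective
    rw [← hg]
    exact (adj.homEquiv_naturality_left _ _).trans (by simp)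

lemma gorensteinProjective_left {F : A ⥤ B} {G : B ⥤ A} [F.Additive] (h : FrobeniusPair F G) :
    gorensteinProjective A ≤ (gorensteinProjective B).inverseImage F := by
  have := h.preservesFiniteLimits_left
  have := h.preservesFiniteColimits_left
  exact gorensteinProjective_le_inverseImage h.adj h.projective_left h.projective_right

lemma gorensteinProjective_right {F : A ⥤ B} {G : B ⥤ A} [G.Additive] (h : FrobeniusPair F G) :
    gorensteinProjective B ≤ (gorensteinProjective A).inverseImage G := by
  have := h.preservesFiniteLimits_right
  have := h.preservesFiniteColimits_right
  refine gorensteinProjective_le_inverseImage h.adj' h.projective_right (fun P hP => ?_)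
  exact (h.β.map_projective_iff _).2 (h.projective_left _ ((h.α.map_projective_iff _).2 hP))

variable {F : A ⥤ B} {G : B ⥤ A} [F.Additive] [G.Additive]

/-- `F` on stable categories of Gorenstein projective objects. -/
def stableLeft (h : FrobeniusPair F G) : StableGP A ⥤ StableGP B :=
  stableMap F h.gorensteinProjective_left h.projective_left

/-- `G` on stable categories of Gorenstein projective objects. -/
def stableRight (h : FrobeniusPair F G) : StableGP B ⥤ StableGP A :=
  stableMap G h.gorensteinProjective_right h.projective_right

/-- The induced adjoint pair on stable categories of Gorenstein projective objects. -/
def stableAdjunction (h : FrobeniusPair F G) : h.stableLeft ⊣ h.stableRight :=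
  stableAdj h.adj _ _ _ _

variable [HasDerivedCategory.{w} A] [HasDerivedCategory.{w'} B]

/-- `F` on singularity categories. -/
def sgLeft (h : FrobeniusPair F G) : Dsg A ⥤ Dsg B :=
  haveI := h.preservesFiniteLimits_left
  haveI := h.preservesFiniteColimits_left
  quotientMap F h.projective_left

/-- `G` on singularity categories. -/
def sgRight (h : FrobeniusPair F G) : Dsg B ⥤ Dsg A :=
  haveI := h.preservesFiniteLimits_right
  haveI := h.preservesFiniteColimits_right
  quotientMap G h.projective_right

/-- The induced adjoint pair on singularity categories. -/
def sgAdjunction (h : FrobeniusPair F G) :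
    (h.sgLeft : Dsg A ⥤ Dsg B) ⊣ (h.sgRight : Dsg B ⥤ Dsg A) :=
  haveI := h.preservesFiniteLimits_left
  haveI := h.preservesFiniteColimits_left
  haveI := h.preservesFiniteLimits_right
  haveI := h.preservesFiniteColimits_right
  quotientAdj h.adj h.projective_left h.projective_right

/-- `F` on Gorenstein defect categories. -/
def defLeft (h : FrobeniusPair F G) : Ddef A ⥤ Ddef B :=
  haveI := h.preservesFiniteLimits_left
  haveI := h.preservesFiniteColimits_left
  quotientMap F h.gorensteinProjective_left

/-- `G` on Gorenstein defect categories. -/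
def defRight (h : FrobeniusPair F G) : Ddef B ⥤ Ddef A :=
  haveI := h.preservesFiniteLimits_right
  haveI := h.preservesFiniteColimits_right
  quotientMap G h.gorensteinProjective_right

/-- The induced adjoint pair on Gorenstein defect categories. -/
def defAdjunction (h : FrobeniusPair F G) :
    (h.defLeft : Ddef A ⥤ Ddef B) ⊣ (h.defRight : Ddef B ⥤ Ddef A) :=
  haveI := h.preservesFiniteLimits_left
  haveI := h.preservesFiniteColimits_left
  haveI := h.preservesFiniteLimits_right
  haveI := h.preservesFiniteColimits_right
  quotientAdj h.adj h.gorensteinProjective_left h.gorensteinProjective_right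

end

end FrobeniusPair

end FrobGor

end

open FrobGor

/-! Faithfulness makes each `η_X` a monomorphism and each `ε_Y` an epimorphism, and the Frobenius
condition makes `F` and `G` exact. Each statement thus asks when a monomorphism or an epimorphism
becomes invertible in a quotient, and the answer is read off its cokernel or kernel.

In the stable category, an epimorphism onto a Gorenstein projective object is invertible exactly
when its kernel is projective. A monomorphism `f : X ⟶ Y` is invertible exactly when its cokernel
has projective dimension at most one. In one direction, adding an embedding of `X` in a projective
`P` turns `f` into a split monomorphism into `Y ⊞ P` with projective cokernel, and `cokernel f` is
the quotient of that cokernel by `P`. In the other, one pulls back along a projective cover of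
`cokernel f`.

The singularity and defect categories are treated together, for a class `𝒞` with `IsResolving 𝒞`.
Membership in `complexesOf 𝒞` is tested on a bounded above projective model `P` of an object of
`D^b`: it means that the opcycles `Pⁿ/Bⁿ` lie in `𝒞` for `n ≪ 0` (`exists_opcycles_mem`,
`complexesOf_of_opcycles_mem`). This yields closure under cones and direct summands, so a morphism
is inverted in the Verdier quotient if and only if its cone lies in the subcategory
(`IsResolving.isIso_Q_map_bounded_iff`). It also shows that a stalk complex belongs to the
subcategory if and only if the object has finite `𝒞`-dimension. Up to a shift, the cone of the unit
or counit on a complex is the termwise cokernel or kernel; stalk complexes give one implication and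
devissage the other.

Gorenstein projectives form a resolving class by `gorensteinProjective_of_coresolving`, which builds
totally acyclic complexes by splicing. -/

noncomputable section

namespace FrobGor

section

open Abelian

variable {A : Type u} [Category.{v} A] [Abelian A]

/-! ### Objects without higher extensions by projective objects -/

section Ext

variable [HasExt.{w} A]

variable (A) in
/-- The objects `X` such that `Extⁿ(X, Q) = 0` for all `n ≥ 1` and all projective `Q`. -/
def extOrthogonal : ObjectProperty A := fun X =>
  ∀ (Q : A) (_ : Projective Q) (n : ℕ) (e : Ext X Q (n + 1)), e = 0

/-- The obstruction to extending `f` is a class in `Ext¹(S.X₃, Q)`. -/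
lemma exists_extension_of_extOrthogonal {S : ShortComplex A} (hS : S.ShortExact)
    (h : extOrthogonal A S.X₃) {Q : A} (hQ : Projective Q) (f : S.X₁ ⟶ Q) :
    ∃ g : S.X₂ ⟶ Q, S.f ≫ g = f := by
  obtain ⟨x, hx⟩ := Ext.contravariant_sequence_exact₁ hS Q (Ext.mk₀ f) (n₁ := 1) (by simp)
    (h Q hQ 0 _)
  obtain ⟨g, rfl⟩ := Ext.homEquiv₀.symm.surjective x
  refine ⟨g, Ext.homEquiv₀.symm.injective ?_⟩
  simpa using hx

lemma extOrthogonal_X₂ {S : ShortComplex A} (hS : S.ShortExact)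
    (h₁ : extOrthogonal A S.X₁) (h₃ : extOrthogonal A S.X₃) : extOrthogonal A S.X₂ := by
  intro Q hQ n e
  obtain ⟨x, rfl⟩ := Ext.contravariant_sequence_exact₂ hS Q e (h₁ Q hQ n _)
  rw [h₃ Q hQ n x, Ext.comp_zero]

lemma extOrthogonal_X₁ {S : ShortComplex A} (hS : S.ShortExact)
    (h₂ : extOrthogonal A S.X₂) (h₃ : extOrthogonal A S.X₃) : extOrthogonal A S.X₁ := by
  intro Q hQ n e
  obtain ⟨x, rfl⟩ := Ext.contravariant_sequence_exact₁ hS Q e (n₁ := n + 1 + 1) (by lia)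
    (h₃ Q hQ _ _)
  rw [h₂ Q hQ n x, Ext.comp_zero]

lemma extOrthogonal_of_retract {X Y : A} (r : Retract X Y) (h : extOrthogonal A Y) :
    extOrthogonal A X := by
  intro Q hQ n e
  rw [← Ext.mk₀_id_comp e, ← r.retract, ← Ext.mk₀_comp_mk₀,
    Ext.comp_assoc_of_second_deg_zero, h Q hQ n (Ext.comp _ _ _), Ext.comp_zero]

lemma extOrthogonal_of_projective {P : A} (hP : Projective P) : extOrthogonal A P :=
  fun _ _ _ e => e.eq_zero_of_projective

end Ext

/-! ### Cocycles in totally acyclic complexes -/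

/-- The short complex `Zⁱ ⟶ Kⁱ ⟶ Zʲ` for `i + 1 = j`. -/
abbrev cyclesShortComplex (K : CochainComplex A ℤ) (i j : ℤ) : ShortComplex A :=
  ShortComplex.mk (K.iCycles i) (K.toCycles i j) (by
    rw [← cancel_mono (K.iCycles j)]
    simp)

lemma cyclesShortComplex_shortExact {K : CochainComplex A ℤ} (i j : ℤ) (hij : i + 1 = j)
    (hK : K.ExactAt j) : (cyclesShortComplex K i j).ShortExact where
  exact := by
    apply ShortComplex.exact_of_f_is_kernel
    exact KernelFork.IsLimit.ofι' _ _ (fun {T} k hk =>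
      ⟨K.liftCycles k j (by simpa using hij) (by
        rw [← K.toCycles_i i j, reassoc_of% hk, zero_comp]), by simp⟩)
  mono_f := by dsimp; infer_instance
  epi_g := by
    have h : (K.sc' i j (j + 1)).Exact := by
      rwa [← K.exactAt_iff' i j (j + 1) (by simp; lia) (by simp)]
    rw [HomologicalComplex.exactAt_iff] at hK
    have := hK.epi_toCycles
    obtain rfl : i = (ComplexShape.up ℤ).prev j := by simp; lia
    exact this

/-- Composing `f` with the epimorphism `P.toCycles (i - 1) i` gives a cocycle of `Hom(P, Q)`; total
acyclicity makes it a coboundary, and the epimorphism cancels. -/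
lemma IsTotallyAcyclic.exists_extension {P : CochainComplex A ℤ} (hP : IsTotallyAcyclic P)
    (i : ℤ) {Q : A} (hQ : Projective Q) (f : P.cycles i ⟶ Q) :
    ∃ g : P.X i ⟶ Q, P.iCycles i ≫ g = f := by
  have hS := cyclesShortComplex_shortExact (i - 1) i (by simp) (hP.acyclic i)
  have := hS.epi_g
  obtain ⟨g, hg⟩ := hP.hom_exact Q hQ (i - 1 - 1) (i - 1) i (by simp) (by simp)
    (P.toCycles (i - 1) i ≫ f) (by simp)
  refine ⟨g, ?_⟩
  rw [← cancel_epi (P.toCycles (i - 1) i), ← hg]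
  simp

/-- Dimension shifting along `Zⁱ⁻¹ ⟶ Pⁱ⁻¹ ⟶ Zⁱ` reduces to `Ext¹`. A class there is the connecting
image of a morphism `Zⁱ⁻¹ ⟶ Q`, which extends to `Pⁱ⁻¹`, so it vanishes. -/
lemma IsTotallyAcyclic.extOrthogonal_cycles [HasExt.{w} A] {P : CochainComplex A ℤ}
    (hP : IsTotallyAcyclic P) (i : ℤ) : extOrthogonal A (P.cycles i) := by
  intro Q hQ n e
  induction n generalizing i with
  | zero =>
    have hS := cyclesShortComplex_shortExact (i - 1) i (by simp) (hP.acyclic i)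
    have := hP.projective (i - 1)
    obtain ⟨x, rfl⟩ := Ext.contravariant_sequence_exact₃ hS Q e
      (Ext.eq_zero_of_projective _) (n₀ := 0) (by simp)
    obtain ⟨f, rfl⟩ := Ext.homEquiv₀.symm.surjective x
    obtain ⟨g, rfl⟩ := hP.exists_extension (i - 1) hQ f
    have h := hS.extClass_comp_assoc (Ext.mk₀ g) (h := rfl)
    simpa using h
  | succ n hn =>
    have hS := cyclesShortComplex_shortExact (i - 1) i (by simp) (hP.acyclic i)
    have := hP.projective (i - 1)
    obtain ⟨x, rfl⟩ := Ext.contravariant_sequence_exact₃ hS Q e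
      (Ext.eq_zero_of_projective _) (n₀ := n + 1) (by lia)
    rw [hn (i - 1) x, Ext.comp_zero]

/-! ### Splicing short exact sequences -/

/-- There is a short exact sequence `0 ⟶ X ⟶ P ⟶ Y ⟶ 0` with `P` projective. -/
def IsSyzygyOf (X Y : A) : Prop :=
  ∃ (P : A) (i : X ⟶ P) (p : P ⟶ Y) (w : i ≫ p = 0), Projective P ∧
    (ShortComplex.mk i p w).ShortExact

/-- Used to splice a coresolution on the right, where the invariant `S` must be propagated, with a
projective resolution on the left, where predecessors always exist. -/
lemma exists_int_sequence {T : Type*} (R : T → T → Prop) (x : T) (S : T → Prop) (hx : S x)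
    (hS : ∀ a, S a → ∃ b, S b ∧ R a b) (hR : ∀ b, ∃ a, R a b) :
    ∃ z : ℤ → T, z 0 = x ∧ ∀ i, R (z i) (z (i + 1)) := by
  choose f hf using hS
  choose g hg using hR
  let r : ℕ → { a // S a } := fun n =>
    Nat.rec ⟨x, hx⟩ (fun _ a => ⟨f a.1 a.2, (hf a.1 a.2).1⟩) n
  let l : ℕ → T := fun n => Nat.rec x (fun _ a => g a) n
  let z : ℤ → T := fun i => match i with
    | .ofNat n => (r n).1
    | .negSucc n => l (n + 1)
  refine ⟨z, rfl, fun i => ?_⟩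
  match i with
  | .ofNat n => exact (hf (r n).1 (r n).2).2
  | .negSucc n =>
    -- The halves meet at `0` because `l 0 = x`.
    have : z (Int.negSucc n + 1) = l n := by
      cases n with
      | zero => rfl
      | succ n => rfl
    rw [this]
    exact hg (l n)

section Splice

variable {K : CochainComplex A ℤ} {Z : ℤ → A} (ι : ∀ i, Z i ⟶ K.X i) (π : ∀ i, K.X i ⟶ Z (i + 1))
  (zero : ∀ i, ι i ≫ π i = 0) (hd : ∀ i, K.d i (i + 1) = π i ≫ ι (i + 1))
  (hS : ∀ i, (ShortComplex.mk (ι i) (π i) (zero i)).ShortExact)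

include hd hS

lemma acyclic_of_splice : K.Acyclic := by
  intro j
  obtain ⟨i, rfl⟩ : ∃ i, j = i + 1 := ⟨j - 1, by simp⟩
  rw [HomologicalComplex.exactAt_iff' _ i (i + 1) (i + 1 + 1) (by simp) (by simp),
    ShortComplex.exact_iff_exact_up_to_refinements]
  intro T (x : T ⟶ K.X (i + 1)) (hx : x ≫ K.d (i + 1) (i + 1 + 1) = 0)
  have : Mono (ι (i + 1 + 1)) := (hS (i + 1 + 1)).mono_f
  have : Epi (π i) := (hS i).epi_g
  have h : x ≫ π (i + 1) = 0 := by
    rw [← cancel_mono (ι (i + 1 + 1)), Category.assoc, ← hd, hx, zero_comp]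
  obtain ⟨y, hy⟩ := KernelFork.IsLimit.lift' (hS (i + 1)).fIsKernel x h
  dsimp at y hy
  obtain ⟨T', ρ, hρ, z, hz⟩ := surjective_up_to_refinements_of_epi (π i) y
  refine ⟨T', ρ, hρ, z, ?_⟩
  change ρ ≫ x = z ≫ K.d i (i + 1)
  rw [← hy, reassoc_of% hz, hd]

lemma nonempty_iso_cycles_of_splice (i : ℤ) : Nonempty (Z i ≅ K.cycles i) := by
  have : Mono (ι i) := (hS i).mono_f
  have : Mono (ι (i + 1)) := (hS (i + 1)).mono_f
  have hk : IsLimit (KernelFork.ofι (f := K.d i (i + 1)) (ι i)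
      (by rw [hd, reassoc_of% (zero i), zero_comp])) :=
    KernelFork.IsLimit.ofι' _ _ (fun {T} k hk => by
      have h : k ≫ π i = 0 := by
        rw [← cancel_mono (ι (i + 1)), Category.assoc, ← hd, hk, zero_comp]
      have := KernelFork.IsLimit.lift' (hS i).fIsKernel k h
      exact ⟨this.1, this.2⟩)
  exact ⟨IsLimit.conePointUniqueUpToIso hk (K.cyclesIsKernel i (i + 1) (by simp))⟩

end Splice

/-! ### Closure properties of the Gorenstein projective objects -/

lemma exists_isSyzygyOf [EnoughProjectives A] (Y : A) : ∃ X : A, IsSyzygyOf X Y :=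
  ⟨kernel (Projective.π Y), Projective.over Y, kernel.ι _, Projective.π Y, kernel.condition _,
    inferInstance,
    { exact := ShortComplex.exact_of_f_is_kernel _ (kernelIsKernel _)
      mono_f := by dsimp; infer_instance
      epi_g := by dsimp; infer_instance }⟩

lemma shortExact_cokernel {X Y : A} (f : X ⟶ Y) [Mono f] :
    (ShortComplex.mk f (cokernel.π f) (cokernel.condition f)).ShortExact where
  exact := ShortComplex.exact_of_g_is_cokernel _ (cokernelIsCokernel _)
  mono_f := by dsimp; infer_instance
  epi_g := by dsimp; infer_instance

lemma shortExact_kernel {X Y : A} (f : X ⟶ Y) [Epi f] :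
    (ShortComplex.mk (kernel.ι f) f (kernel.condition f)).ShortExact where
  exact := ShortComplex.exact_of_f_is_kernel _ (kernelIsKernel _)
  mono_f := by dsimp; infer_instance
  epi_g := by dsimp; infer_instance

/-- The cokernels of two composable monomorphisms and of their composition. -/
lemma shortExact_cokernel_comp {X Y Z : A} (f : X ⟶ Y) (g : Y ⟶ Z) [Mono g] :
    (ShortComplex.mk (cokernel.map f (f ≫ g) (𝟙 _) g (by simp))
      (cokernel.map (f ≫ g) g f (𝟙 _) (by simp)) (by
        rw [← cancel_epi (cokernel.π f)]; simp)).ShortExact where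
  exact := (kernelCokernelCompSequence_exact f g).exact 3
  mono_f := by
    have h := (kernelCokernelCompSequence_exact f g).exact 2
    exact (ShortComplex.exact_iff_mono _ ((isZero_kernel_of_mono g).eq_of_src _ _)).1 h
  epi_g := by dsimp; infer_instance

/-- A class of objects without extensions by projective objects, each of which embeds in a
projective object with cokernel in the class, consists of Gorenstein projective objects. -/
lemma gorensteinProjective_of_coresolving [EnoughProjectives A] [HasExt.{w} A]
    (S : ObjectProperty A) (hS : S ≤ extOrthogonal A)
    (hS' : ∀ X, S X → ∃ (P : A) (i : X ⟶ P), Projective P ∧ Mono i ∧ S (cokernel i)) :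
    S ≤ gorensteinProjective A := by
  intro M hM
  obtain ⟨z, hz₀, hz⟩ := exists_int_sequence
    (T := { X : A // extOrthogonal A X }) (fun X Y => IsSyzygyOf X.1 Y.1)
    ⟨M, hS M hM⟩ (fun X => S X.1) hM (fun X hX => by
      obtain ⟨P, i, hP, hi, h⟩ := hS' _ hX
      exact ⟨⟨cokernel i, hS _ h⟩, h, P, i, cokernel.π i, cokernel.condition i, hP,
        shortExact_cokernel i⟩) (fun Y => by
      obtain ⟨X, P, i, p, w, hP, hS⟩ := exists_isSyzygyOf Y.1
      exact ⟨⟨X, extOrthogonal_X₁ hS (extOrthogonal_of_projective hP) Y.2⟩, P, i, p, w, hP, hS⟩)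
  choose P ι π zero hP hex using hz
  let K : CochainComplex A ℤ := CochainComplex.of P (fun i => π i ≫ ι (i + 1)) (fun i => by
    rw [Category.assoc, reassoc_of% (zero (i + 1)), zero_comp, comp_zero])
  have hd (i : ℤ) : K.d i (i + 1) = π i ≫ ι (i + 1) :=
    CochainComplex.of_d P (fun i => π i ≫ ι (i + 1)) i
  have hK : K.Acyclic := acyclic_of_splice (K := K) ι π zero hd hex
  refine ⟨K, ⟨hP, hK, ?_⟩, ?_⟩
  · rintro Q hQ i _ _ rfl rfl f hf
    have : Epi (π i) := (hex i).epi_g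
    -- A cocycle `f` factors through the next spliced object, whose embedding in the next projective
    -- term has an orthogonal cokernel; hence the factorization extends to that term.
    have hf' : ι (i + 1) ≫ f = 0 := by
      rw [← cancel_epi (π i), comp_zero]
      rw [hd] at hf
      exact (Category.assoc _ _ _).symm.trans hf
    obtain ⟨g, hg⟩ := CokernelCofork.IsColimit.desc' (hex (i + 1)).gIsCokernel f hf'
    obtain ⟨k, hk⟩ := exists_extension_of_extOrthogonal (hex (i + 1 + 1)) (z (i + 1 + 1 + 1)).2 hQ g
    refine ⟨k, ?_⟩
    rw [hd]
    refine (Category.assoc _ _ _).trans ?_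
    refine Eq.trans ?_ hg
    exact congrArg (π (i + 1) ≫ ·) hk
  · obtain ⟨e⟩ := nonempty_iso_cycles_of_splice (K := K) ι π zero hd hex 0
    exact ⟨eqToIso (by rw [hz₀]) ≪≫ e⟩

lemma gorensteinProjective_of_iso {X Y : A} (e : X ≅ Y) (h : gorensteinProjective A X) :
    gorensteinProjective A Y := by
  obtain ⟨P, hP, ⟨e'⟩⟩ := h
  exact ⟨P, hP, ⟨e.symm ≪≫ e'⟩⟩

lemma extOrthogonal_of_gorensteinProjective [HasExt.{w} A] {X : A}
    (h : gorensteinProjective A X) : extOrthogonal A X := by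
  obtain ⟨P, hP, ⟨e⟩⟩ := h
  exact extOrthogonal_of_retract e.retract (hP.extOrthogonal_cycles 0)

lemma exists_extension_of_gorensteinProjective {S : ShortComplex A} (hS : S.ShortExact)
    (h : gorensteinProjective A S.X₃) {Q : A} (hQ : Projective Q) (f : S.X₁ ⟶ Q) :
    ∃ g : S.X₂ ⟶ Q, S.f ≫ g = f := by
  let := HasExt.standard A
  exact exists_extension_of_extOrthogonal hS (extOrthogonal_of_gorensteinProjective h) hQ f

variable [EnoughProjectives A]

/-- The definition only mentions degree `0`; the cocycles of `P` in all degrees form a coresolving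
class, so `P` need not be shifted. -/
lemma IsTotallyAcyclic.gorensteinProjective_cycles {P : CochainComplex A ℤ}
    (hP : IsTotallyAcyclic P) (i : ℤ) : gorensteinProjective A (P.cycles i) := by
  let := HasExt.standard A
  refine gorensteinProjective_of_coresolving (fun X => ∃ i : ℤ, Nonempty (X ≅ P.cycles i)) ?_ ?_ _
    ⟨i, ⟨Iso.refl _⟩⟩
  · rintro X ⟨i, ⟨e⟩⟩
    exact extOrthogonal_of_retract e.retract (hP.extOrthogonal_cycles i)
  · rintro X ⟨i, ⟨e⟩⟩
    have hS := cyclesShortComplex_shortExact i (i + 1) rfl (hP.acyclic (i + 1))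
    refine ⟨P.X i, e.hom ≫ P.iCycles i, hP.projective i, inferInstance, i + 1, ⟨?_⟩⟩
    exact cokernelEpiComp _ _ ≪≫
      IsColimit.coconePointUniqueUpToIso (colimit.isColimit _) hS.gIsCokernel

lemma gorensteinProjective.exists_embedding {X : A} (h : gorensteinProjective A X) :
    ∃ (P : A) (i : X ⟶ P), Projective P ∧ Mono i ∧ gorensteinProjective A (cokernel i) := by
  obtain ⟨P, hP, ⟨e⟩⟩ := h
  have hS := cyclesShortComplex_shortExact 0 1 rfl (hP.acyclic 1)
  refine ⟨P.X 0, e.hom ≫ P.iCycles 0, hP.projective 0, inferInstance,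
    gorensteinProjective_of_iso (cokernelEpiComp _ _ ≪≫
      IsColimit.coconePointUniqueUpToIso (colimit.isColimit _) hS.gIsCokernel).symm
      (hP.gorensteinProjective_cycles 1)⟩

lemma gorensteinProjective.exists_cover {X : A} (h : gorensteinProjective A X) :
    ∃ (P : A) (p : P ⟶ X), Projective P ∧ Epi p ∧ gorensteinProjective A (kernel p) := by
  obtain ⟨P, hP, ⟨e⟩⟩ := h
  have hS := cyclesShortComplex_shortExact (-1) 0 rfl (hP.acyclic 0)
  have : Epi (P.toCycles (-1) 0) := hS.epi_g
  refine ⟨P.X (-1), P.toCycles (-1) 0 ≫ e.inv, hP.projective _, inferInstance,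
    gorensteinProjective_of_iso (kernelCompMono _ _ ≪≫
      IsLimit.conePointUniqueUpToIso (limit.isLimit _) hS.fIsKernel).symm
      (hP.gorensteinProjective_cycles (-1))⟩

lemma gorensteinProjective_of_projective {P : A} (hP : Projective P) :
    gorensteinProjective A P := by
  let := HasExt.standard A
  refine gorensteinProjective_of_coresolving (fun X => Projective X) ?_ ?_ _ hP
  · intro X hX
    exact extOrthogonal_of_projective hX
  · intro X hX
    refine ⟨X, 𝟙 X, hX, inferInstance, ?_⟩
    have : IsZero (cokernel (𝟙 X)) := isZero_cokernel_of_epi _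
    exact this.projective

end

/-! ### Extensions, direct summands and kernels of epimorphisms -/

section

open Abelian

variable {A : Type u} [Category.{v} A] [Abelian A]

/-- If `a : E ⟶ P` restricts to the inclusion of `X` in `P`, then the cokernel of
`E ⟶ P ⊞ Y` is the cokernel of `X ⟶ P`. -/
lemma exists_shortExact_lift {X E Y P C : A} {f : X ⟶ E} {g : E ⟶ Y} {w : f ≫ g = 0}
    (hS : (ShortComplex.mk f g w).ShortExact) {p : P ⟶ C} {a : E ⟶ P}
    {w' : (f ≫ a) ≫ p = 0} (hS' : (ShortComplex.mk (f ≫ a) p w').ShortExact) :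
    ∃ (q : P ⊞ Y ⟶ C) (h : biprod.lift a g ≫ q = 0),
      (ShortComplex.mk (biprod.lift a g) q h).ShortExact := by
  have : Epi g := hS.epi_g
  have : Epi p := hS'.epi_g
  have : Mono f := hS.mono_f
  have hm : Mono (f ≫ a) := hS'.mono_f
  obtain ⟨t, ht⟩ := CokernelCofork.IsColimit.desc' hS.gIsCokernel (a ≫ p)
    (by simpa using w')
  dsimp at t ht
  -- The sequence is that of the square with sides `a`, `g`, `p`, `t`; the sign makes the composite
  -- vanish.
  refine ⟨biprod.desc p (-t), by simp [ht], ?_⟩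
  refine { exact := ?_, mono_f := ?_, epi_g := ?_ }
  · rw [ShortComplex.exact_iff_exact_up_to_refinements]
    intro T x hx
    dsimp at x hx ⊢
    obtain ⟨x₁, x₂, rfl⟩ : ∃ x₁ x₂, x = biprod.lift x₁ x₂ :=
      ⟨x ≫ biprod.fst, x ≫ biprod.snd, by ext <;> simp⟩
    have hx' : x₁ ≫ p = x₂ ≫ t := by
      rw [← sub_eq_zero, sub_eq_add_neg]
      simpa using hx
    obtain ⟨T', ρ, hρ, e, he⟩ := surjective_up_to_refinements_of_epi g x₂
    -- The lift `e` of `x₂` has the right component in `Y`; its error in `P` is killed by `p`, so it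
    -- comes from `X`.
    obtain ⟨m, hm'⟩ := KernelFork.IsLimit.lift' hS'.fIsKernel (ρ ≫ x₁ - e ≫ a) (by
      dsimp
      rw [Preadditive.sub_comp, Category.assoc, Category.assoc, hx', ← ht, reassoc_of% he,
        sub_self])
    dsimp at m hm'
    refine ⟨T', ρ, hρ, e + m ≫ f, ?_⟩
    ext
    · simp only [Category.assoc, biprod.lift_fst, Preadditive.add_comp]
      rw [hm']
      abel
    · simp [he, w]
  · dsimp
    refine Preadditive.mono_of_cancel_zero _ (fun {T} x hx => ?_)
    have h₁ : x ≫ a = 0 := by simpa using hx =≫ biprod.fst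
    have h₂ : x ≫ g = 0 := by simpa using hx =≫ biprod.snd
    obtain ⟨m, hm'⟩ := KernelFork.IsLimit.lift' hS.fIsKernel x h₂
    dsimp at m hm'
    have : m = 0 := by
      rw [← cancel_mono (f ≫ a), reassoc_of% hm', h₁, zero_comp]
    rw [← hm', this, zero_comp]
  · dsimp
    exact epi_of_epi_fac (f := biprod.inl) (h := p) (by simp)

lemma shortExact_biprod_map {X Y Z : A} (P : A) {f : X ⟶ Y} {g : Y ⟶ Z} {w : f ≫ g = 0}
    (hS : (ShortComplex.mk f g w).ShortExact) :
    (ShortComplex.mk (biprod.map (𝟙 P) f) (biprod.snd ≫ g) (by simp [w])).ShortExact := by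
  have : Epi g := hS.epi_g
  have : Mono f := hS.mono_f
  refine { exact := ?_, mono_f := by dsimp; infer_instance, epi_g := by dsimp; infer_instance }
  apply ShortComplex.exact_of_f_is_kernel
  exact KernelFork.IsLimit.ofι' _ _ (fun {T} k hk => by
    have := KernelFork.IsLimit.lift' hS.fIsKernel (k ≫ biprod.snd) (by simpa using hk)
    refine ⟨biprod.lift (k ≫ biprod.fst) this.1, ?_⟩
    have h := this.2
    dsimp at h
    dsimp
    ext <;> simp [h])

/-- The cokernel of the monomorphism of a short exact sequence. -/
def cokernelIsoOfShortExact {S : ShortComplex A} (hS : S.ShortExact) : cokernel S.f ≅ S.X₃ :=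
  IsColimit.coconePointUniqueUpToIso (colimit.isColimit _) hS.gIsCokernel

/-- The kernel of the epimorphism of a short exact sequence. -/
def kernelIsoOfShortExact {S : ShortComplex A} (hS : S.ShortExact) : kernel S.g ≅ S.X₁ :=
  IsLimit.conePointUniqueUpToIso (limit.isLimit _) hS.fIsKernel

/-- The kernel of the first projection of a pullback. -/
lemma shortExact_pullback_fst {X Y Z : A} (f : X ⟶ Z) (g : Y ⟶ Z) [Epi g] :
    (ShortComplex.mk (pullback.lift 0 (kernel.ι g) (by simp) : kernel g ⟶ pullback f g)
      (pullback.fst f g) (pullback.lift_fst _ _ _)).ShortExact := by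
  have hw : (0 : kernel g ⟶ X) ≫ f = kernel.ι g ≫ g := by simp
  have : Mono (pullback.lift 0 (kernel.ι g) hw : kernel g ⟶ pullback f g) :=
    mono_of_mono_fac (pullback.lift_snd _ _ _)
  refine { exact := ?_, mono_f := this, epi_g := by dsimp; infer_instance }
  apply ShortComplex.exact_of_f_is_kernel
  refine KernelFork.IsLimit.ofι' _ _ (fun {T} (k : T ⟶ pullback f g)
    (hk : k ≫ pullback.fst f g = 0) => ⟨kernel.lift g (k ≫ pullback.snd f g) ?_, ?_⟩)
  · rw [Category.assoc, ← pullback.condition, reassoc_of% hk, zero_comp]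
  · dsimp
    apply pullback.hom_ext
    · rw [Category.assoc, pullback.lift_fst, comp_zero, hk]
    · rw [Category.assoc, pullback.lift_snd, kernel.lift_ι]

/-- If `X` is a retract of `M` and `M` embeds in `P`, then `X ⊞ P/X` is an extension of `P/M`
by `M`. -/
lemma shortExact_biprod_cokernel {X M P : A} (r : Retract X M) (j : M ⟶ P) [Mono j] :
    (ShortComplex.mk (biprod.lift r.r (j ≫ cokernel.π (r.i ≫ j)))
      (biprod.snd ≫ cokernel.map (r.i ≫ j) j r.i (𝟙 _) (by simp)) (by simp)).ShortExact := by
  refine { exact := ?_, mono_f := ?_, epi_g := by dsimp; infer_instance }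
  · rw [ShortComplex.exact_iff_exact_up_to_refinements]
    intro T x hx
    dsimp at x hx ⊢
    obtain ⟨x₁, x₂, rfl⟩ : ∃ x₁ x₂, x = biprod.lift x₁ x₂ :=
      ⟨x ≫ biprod.fst, x ≫ biprod.snd, by ext <;> simp⟩
    obtain ⟨T', ρ, hρ, y, hy⟩ :=
      surjective_up_to_refinements_of_epi (cokernel.π (r.i ≫ j)) x₂
    obtain ⟨m, hm⟩ := KernelFork.IsLimit.lift' (shortExact_cokernel j).fIsKernel y (by
      have h := ρ ≫= hx
      rw [biprod.lift_snd_assoc, reassoc_of% hy] at h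
      simpa using h)
    dsimp at m hm
    -- The component of `m` along `X` is replaced by `ρ ≫ x₁`; this is invisible in `P/X`.
    refine ⟨T', ρ, hρ, m - m ≫ r.r ≫ r.i + ρ ≫ x₁ ≫ r.i, ?_⟩
    have hz : r.i ≫ j ≫ cokernel.π (r.i ≫ j) = 0 := by
      rw [← Category.assoc, cokernel.condition]
    ext
    · simp
    · simp [hy, hz, ← hm]
  · dsimp
    refine Preadditive.mono_of_cancel_zero _ (fun {T} x hx => ?_)
    have h₁ : x ≫ r.r = 0 := by simpa using hx =≫ biprod.fst
    have h₂ : (x ≫ j) ≫ cokernel.π (r.i ≫ j) = 0 := by simpa using hx =≫ biprod.snd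
    obtain ⟨m, hm⟩ := KernelFork.IsLimit.lift' (shortExact_cokernel (r.i ≫ j)).fIsKernel _ h₂
    dsimp at m hm
    have h₃ : x = m ≫ r.i := by
      rw [← cancel_mono j, ← hm, Category.assoc]
    have : m = 0 := by
      rw [← h₁, h₃]
      simp
    rw [h₃, this, zero_comp]

variable [EnoughProjectives A]

/-- A horseshoe argument: for an extension `E` of `Y` by `X`, the embedding `X ⟶ P` extends to `E`
since `Y` is `Ext`-orthogonal. Then `E` embeds in `P ⊞ Y`, hence in `P ⊞ R`, and the cokernel is
again an extension of Gorenstein projectives. -/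
lemma gorensteinProjective_X₂ {S : ShortComplex A} (hS : S.ShortExact)
    (h₁ : gorensteinProjective A S.X₁) (h₃ : gorensteinProjective A S.X₃) :
    gorensteinProjective A S.X₂ := by
  let := HasExt.standard A
  refine gorensteinProjective_of_coresolving
    (fun E => ∃ (X Y : A) (f : X ⟶ E) (g : E ⟶ Y) (w : f ≫ g = 0),
      gorensteinProjective A X ∧ gorensteinProjective A Y ∧ (ShortComplex.mk f g w).ShortExact)
    ?_ ?_ _ ⟨_, _, _, _, _, h₁, h₃, hS⟩
  · rintro E ⟨X, Y, f, g, w, hX, hY, hS⟩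
    exact extOrthogonal_X₂ hS (extOrthogonal_of_gorensteinProjective hX)
      (extOrthogonal_of_gorensteinProjective hY)
  · rintro E ⟨X, Y, f, g, w, hX, hY, hS⟩
    obtain ⟨P, i, hP, hi, hi'⟩ := hX.exists_embedding
    obtain ⟨R, j, hR, hj, hj'⟩ := hY.exists_embedding
    obtain ⟨a, rfl⟩ := exists_extension_of_gorensteinProjective hS hY hP i
    obtain ⟨q, hq, hS₁⟩ := exists_shortExact_lift hS (shortExact_cokernel (f ≫ a))
    have hS₂ := shortExact_biprod_map P (shortExact_cokernel j)
    have : Mono (biprod.lift a g) := hS₁.mono_f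
    have : Mono (biprod.map (𝟙 P) j) := hS₂.mono_f
    refine ⟨P ⊞ R, biprod.lift a g ≫ biprod.map (𝟙 P) j, inferInstance, inferInstance,
      _, _, _, _, _, ?_, ?_, shortExact_cokernel_comp _ _⟩
    · exact gorensteinProjective_of_iso (cokernelIsoOfShortExact hS₁).symm hi'
    · exact gorensteinProjective_of_iso (cokernelIsoOfShortExact hS₂).symm hj'

lemma gorensteinProjective_biprod {X Y : A} (hX : gorensteinProjective A X)
    (hY : gorensteinProjective A Y) : gorensteinProjective A (X ⊞ Y) :=
  gorensteinProjective_X₂ (ShortComplex.Splitting.ofHasBinaryBiproduct X Y).shortExact hX hY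

/-- For `X` a retract of `M ⊆ P`, the object `X ⊞ P/X` is an extension of `P/M` by `M`. So `P/X` is
again a retract of a Gorenstein projective, and retracts form a coresolving class. -/
lemma gorensteinProjective_of_retract {X M : A} (r : Retract X M)
    (hM : gorensteinProjective A M) : gorensteinProjective A X := by
  let := HasExt.standard A
  refine gorensteinProjective_of_coresolving
    (fun X => ∃ (M : A) (_ : Retract X M), gorensteinProjective A M) ?_ ?_ _ ⟨M, r, hM⟩
  · rintro X ⟨M, r, hM⟩
    exact extOrthogonal_of_retract r (extOrthogonal_of_gorensteinProjective hM)
  · rintro X ⟨M, r, hM⟩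
    obtain ⟨P, j, hP, hj, hj'⟩ := hM.exists_embedding
    refine ⟨P, r.i ≫ j, hP, inferInstance, X ⊞ cokernel (r.i ≫ j),
      ⟨biprod.inr, biprod.snd, by simp⟩, ?_⟩
    exact gorensteinProjective_X₂ (shortExact_biprod_cokernel r j) hM hj'

/-- The pullback of `S.g` along a projective cover of `S.X₃` is an extension of `S.X₂` by a
Gorenstein projective. It also splits over the projective, which makes `S.X₁` a retract of it. -/
lemma gorensteinProjective_X₁ {S : ShortComplex A} (hS : S.ShortExact)
    (h₂ : gorensteinProjective A S.X₂) (h₃ : gorensteinProjective A S.X₃) :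
    gorensteinProjective A S.X₁ := by
  obtain ⟨P, p, hP, hp, hK⟩ := h₃.exists_cover
  have : Epi S.g := hS.epi_g
  have hE : gorensteinProjective A (pullback S.g p) :=
    gorensteinProjective_X₂ (shortExact_pullback_fst S.g p) hK h₂
  have hE' : gorensteinProjective A (pullback p S.g) :=
    gorensteinProjective_of_iso (pullbackSymmetry _ _) hE
  have hS' := shortExact_pullback_fst p S.g
  let s := hS'.splittingOfProjective
  refine gorensteinProjective_of_iso (kernelIsoOfShortExact hS) ?_
  exact gorensteinProjective_of_retract ⟨_, s.r, s.f_r⟩ hE'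

end

section

open Abelian

open scoped ZeroObject

section StableIso

variable {A : Type u} [Category.{v} A]

/-! ### Stable isomorphisms -/

/-- The morphism `f` factors through a projective object. -/
def FactorsThroughProjective {X Y : A} (f : X ⟶ Y) : Prop :=
  ∃ (P : A) (_ : Projective P) (a : X ⟶ P) (b : P ⟶ Y), f = a ≫ b

namespace FactorsThroughProjective

lemma comp_of_projective {X P Y : A} (hP : Projective P) (a : X ⟶ P) (b : P ⟶ Y) :
    FactorsThroughProjective (a ≫ b) :=
  ⟨P, hP, a, b, rfl⟩

lemma precomp {X Y Z : A} {g : Y ⟶ Z} (hg : FactorsThroughProjective g) (f : X ⟶ Y) :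
    FactorsThroughProjective (f ≫ g) := by
  obtain ⟨P, hP, a, b, rfl⟩ := hg
  exact ⟨P, hP, f ≫ a, b, by simp⟩

lemma postcomp {X Y Z : A} {f : X ⟶ Y} (hf : FactorsThroughProjective f) (g : Y ⟶ Z) :
    FactorsThroughProjective (f ≫ g) := by
  obtain ⟨P, hP, a, b, rfl⟩ := hf
  exact ⟨P, hP, a, b ≫ g, by simp⟩

lemma projective_of_id {X : A} (h : FactorsThroughProjective (𝟙 X)) : Projective X := by
  obtain ⟨P, hP, a, b, hab⟩ := h
  exact Retract.projective (Y := P) ⟨a, b, hab.symm⟩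

variable [Abelian A]

lemma zero (X Y : A) : FactorsThroughProjective (0 : X ⟶ Y) :=
  ⟨0, inferInstance, 0, 0, by simp⟩

lemma neg {X Y : A} {f : X ⟶ Y} (hf : FactorsThroughProjective f) :
    FactorsThroughProjective (-f) := by
  obtain ⟨P, hP, a, b, rfl⟩ := hf
  exact ⟨P, hP, -a, b, by simp⟩

lemma add {X Y : A} {f g : X ⟶ Y} (hf : FactorsThroughProjective f)
    (hg : FactorsThroughProjective g) : FactorsThroughProjective (f + g) := by
  obtain ⟨P, hP, a, b, rfl⟩ := hf
  obtain ⟨Q, hQ, c, d, rfl⟩ := hg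
  exact ⟨P ⊞ Q, inferInstance, biprod.lift a c, biprod.desc b d, by simp⟩

lemma sub {X Y : A} {f g : X ⟶ Y} (hf : FactorsThroughProjective f)
    (hg : FactorsThroughProjective g) : FactorsThroughProjective (f - g) := by
  rw [sub_eq_add_neg]
  exact hf.add hg.neg

end FactorsThroughProjective

variable [Abelian A]

/-- The morphism `f` is invertible modulo the morphisms factoring through projective objects. -/
def IsStableIso {X Y : A} (f : X ⟶ Y) : Prop :=
  ∃ s : Y ⟶ X, FactorsThroughProjective (f ≫ s - 𝟙 X) ∧ FactorsThroughProjective (s ≫ f - 𝟙 Y)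

lemma projective_kernel_of_isStableIso {X Y : A} (f : X ⟶ Y) [Epi f] (hf : IsStableIso f) :
    Projective (kernel f) := by
  obtain ⟨s, h₁, Q, hQ, a, b, h₂⟩ := hf
  -- Lifting `b` through `f` corrects the stable inverse `s` to an honest section. The complementary
  -- idempotent projects onto `kernel f` and factors through a projective, hence so does the
  -- identity of `kernel f`.
  obtain ⟨b', rfl⟩ : ∃ b', b' ≫ f = b := ⟨Projective.factorThru b f, by simp⟩
  have hs : (s - a ≫ b') ≫ f = 𝟙 Y := by
    rw [Preadditive.sub_comp, Category.assoc, ← h₂]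
    abel
  have h : FactorsThroughProjective (𝟙 X - f ≫ (s - a ≫ b')) := by
    have := (h₁.sub ((FactorsThroughProjective.comp_of_projective hQ a b').precomp f)).neg
    convert this using 1
    rw [Preadditive.comp_sub]
    abel
  let ρ : X ⟶ kernel f := kernel.lift f (𝟙 X - f ≫ (s - a ≫ b')) (by
    rw [Preadditive.sub_comp, Category.assoc, hs]
    simp)
  have hρ : ρ ≫ kernel.ι f = 𝟙 X - f ≫ (s - a ≫ b') := kernel.lift_ι _ _ _
  have hρ' : kernel.ι f ≫ ρ = 𝟙 _ := by
    rw [← cancel_mono (kernel.ι f), Category.assoc, hρ, Preadditive.comp_sub,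
      kernel.condition_assoc]
    simp
  apply FactorsThroughProjective.projective_of_id
  have : 𝟙 _ = kernel.ι f ≫ (𝟙 X - f ≫ (s - a ≫ b')) ≫ ρ := by
    rw [← hρ, Category.assoc, hρ', Category.comp_id, hρ']
  rw [this]
  exact (h.postcomp ρ).precomp _

/-- `Ext¹(Y, kernel f)` vanishes, so `f` is a split epimorphism with projective kernel. -/
lemma isStableIso_of_projective_kernel {X Y : A} (f : X ⟶ Y) [Epi f]
    (hY : gorensteinProjective A Y) (hf : Projective (kernel f)) : IsStableIso f := by
  have hS := shortExact_kernel f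
  obtain ⟨ρ, hρ⟩ := exists_extension_of_gorensteinProjective hS hY hf (𝟙 _)
  let σ := ShortComplex.Splitting.ofExactOfRetraction _ hS.exact ρ hρ hS.epi_g
  have h₁ : σ.s ≫ f = 𝟙 Y := σ.s_g
  have h₂ : ρ ≫ kernel.ι f + f ≫ σ.s = 𝟙 X := σ.id
  refine ⟨σ.s, ?_, ?_⟩
  · convert (FactorsThroughProjective.comp_of_projective hf ρ (kernel.ι f)).neg using 1
    rw [← h₂]
    abel
  · rw [h₁, sub_self]
    exact .zero _ _

/-- With `i : X ⟶ P` an embedding with Gorenstein projective cokernel, `(f, i) : X ⟶ Y ⊞ P` is split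
and its complement is projective. The quotient of this complement by `P` is `cokernel f`. -/
lemma hasProjectiveDimensionLE_cokernel_of_isStableIso [EnoughProjectives A] {X Y : A} (f : X ⟶ Y)
    [Mono f] (hX : gorensteinProjective A X) (hf : IsStableIso f) :
    HasProjectiveDimensionLE (cokernel f) 1 := by
  obtain ⟨P, i, hP, hi, hi'⟩ := hX.exists_embedding
  obtain ⟨s, ⟨Q, hQ, a, b, h₁⟩, h₂⟩ := hf
  -- Extending `a` to `P` lets the defect `f ≫ s - 𝟙 X` be absorbed by the summand `P`.
  obtain ⟨a', rfl⟩ : ∃ a' : P ⟶ Q, i ≫ a' = a :=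
    exists_extension_of_gorensteinProjective (shortExact_cokernel i) hi' hQ a
  let g : X ⟶ Y ⊞ P := biprod.lift f i
  have hg₁ : g ≫ biprod.fst = f := biprod.lift_fst _ _
  have hg₂ : g ≫ biprod.snd = i := biprod.lift_snd _ _
  have hg : g = f ≫ biprod.inl + i ≫ biprod.inr := by ext <;> simp [g]
  let r : Y ⊞ P ⟶ X := biprod.fst ≫ s - biprod.snd ≫ a' ≫ b
  have hr : g ≫ r = 𝟙 X := by
    rw [Preadditive.comp_sub, reassoc_of% hg₁, reassoc_of% hg₂]
    rw [Category.assoc] at h₁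
    rw [← h₁]
    abel
  have h : FactorsThroughProjective (𝟙 _ - r ≫ g) := by
    have e : 𝟙 _ - r ≫ g = -(biprod.fst ≫ (s ≫ f - 𝟙 Y) ≫ biprod.inl) -
        ((biprod.fst ≫ s) ≫ (i ≫ biprod.inr)) + biprod.snd ≫ biprod.inr +
        biprod.snd ≫ (a' ≫ b ≫ g) := by
      rw [← biprod.total, Preadditive.sub_comp]
      nth_rw 1 [hg]
      simp only [Preadditive.comp_add, Preadditive.sub_comp, Preadditive.comp_sub, Category.assoc,
        Category.id_comp]
      abel
    rw [e]
    refine ((((h₂.postcomp _).precomp _).neg.sub ?_).add ?_).add ?_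
    · rw [← Category.assoc]
      exact .comp_of_projective hP _ _
    · exact .comp_of_projective hP _ _
    · exact .comp_of_projective hP _ _
  let σ : cokernel g ⟶ Y ⊞ P := cokernel.desc g (𝟙 _ - r ≫ g) (by
    rw [Preadditive.comp_sub, reassoc_of% hr, Category.comp_id, sub_self])
  have hσ : cokernel.π g ≫ σ = 𝟙 _ - r ≫ g := cokernel.π_desc _ _ _
  have hσ' : σ ≫ cokernel.π g = 𝟙 _ := by
    rw [← cancel_epi (cokernel.π g), reassoc_of% hσ, Preadditive.sub_comp, Category.assoc,
      cokernel.condition]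
    simp
  have hC : Projective (cokernel g) := by
    apply FactorsThroughProjective.projective_of_id
    have : 𝟙 _ = σ ≫ (𝟙 _ - r ≫ g) ≫ cokernel.π g := by
      rw [← hσ, Category.assoc, hσ', Category.comp_id, hσ']
    rw [this]
    exact (h.postcomp _).precomp _
  have hm : Mono (g ≫ (biprod.fst : Y ⊞ P ⟶ Y)) := by rw [hg₁]; infer_instance
  -- Since `g ≫ biprod.fst = f` is mono and `biprod.fst` is epi, what remains is `0 ⟶ P ⟶ cokernel g
  -- ⟶ cokernel f ⟶ 0`.
  have hex := kernelCokernelCompSequence_exact g (biprod.fst : Y ⊞ P ⟶ Y)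
  have hS : (hex.sc 2).ShortExact :=
    { exact := hex.exact 2
      mono_f := by
        have h := hex.exact 1
        exact (ShortComplex.exact_iff_mono _ ((isZero_kernel_of_mono (g ≫ biprod.fst)).eq_of_src
          _ _)).1 h
      epi_g := by
        have h := hex.exact 3
        exact (ShortComplex.exact_iff_epi _
          ((isZero_cokernel_of_epi (biprod.fst : Y ⊞ P ⟶ Y)).eq_of_tgt _ _)).1 h }
  have hK : Projective (kernel (biprod.fst : Y ⊞ P ⟶ Y)) :=
    Projective.of_iso (IsLimit.conePointUniqueUpToIso (biprod.isKernelFstKernelFork Y P)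
      (limit.isLimit _)) hP
  have := hS.hasProjectiveDimensionLT_X₃ 1
    (projective_iff_hasProjectiveDimensionLT_one.1 hK)
    (by
      have : HasProjectiveDimensionLT (cokernel g) 1 :=
        projective_iff_hasProjectiveDimensionLT_one.1 hC
      exact hasProjectiveDimensionLT_of_ge (cokernel g) 1 2 (by simp))
  have e : cokernel (g ≫ (biprod.fst : Y ⊞ P ⟶ Y)) ≅ cokernel f := cokernelIsoOfEq hg₁
  have : HasProjectiveDimensionLT (cokernel (g ≫ (biprod.fst : Y ⊞ P ⟶ Y))) 2 := this
  exact hasProjectiveDimensionLT_of_iso e 2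

/-- The pullback of `cokernel.π f` along the projective cover `p` splits in two ways. Over `Y` it
splits because `kernel p` is projective and `Y` is Gorenstein projective; over the source of `p` it
splits because that source is projective, with kernel `X`. The section `τ` followed by the
retraction `θ` is a stable inverse of `f`. -/
lemma isStableIso_of_hasProjectiveDimensionLE_cokernel [EnoughProjectives A] {X Y : A} (f : X ⟶ Y)
    [Mono f] (hY : gorensteinProjective A Y) (hf : HasProjectiveDimensionLE (cokernel f) 1) :
    IsStableIso f := by
  let p := Projective.π (cokernel f)
  have hK : Projective (kernel p) := by
    rw [projective_iff_hasProjectiveDimensionLT_one]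
    exact (shortExact_kernel p).hasProjectiveDimensionLT_X₁ 1
      (by dsimp; infer_instance) hf
  have hS := shortExact_pullback_fst (cokernel.π f) p
  obtain ⟨ρ, hρ⟩ := exists_extension_of_gorensteinProjective hS hY hK (𝟙 _)
  let τ := (ShortComplex.Splitting.ofExactOfRetraction _ hS.exact ρ hρ hS.epi_g).s
  have hτ : τ ≫ pullback.fst _ _ = 𝟙 Y :=
    (ShortComplex.Splitting.ofExactOfRetraction _ hS.exact ρ hρ hS.epi_g).s_g
  let σ : Projective.over (cokernel f) ⟶ pullback (cokernel.π f) p :=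
    Projective.factorThru (𝟙 _) (pullback.snd _ _)
  have hσ : σ ≫ pullback.snd _ _ = 𝟙 _ := Projective.factorThru_comp _ _
  obtain ⟨θ, hθ⟩ := KernelFork.IsLimit.lift' (shortExact_cokernel f).fIsKernel
    ((𝟙 _ - pullback.snd (cokernel.π f) p ≫ σ) ≫ pullback.fst _ _) (by
      dsimp
      rw [Category.assoc, pullback.condition, Preadditive.sub_comp, Category.assoc,
        reassoc_of% hσ]
      simp)
  dsimp at θ hθ
  let k : X ⟶ pullback (cokernel.π f) p := pullback.lift f 0 (by simp)
  have hk₁ : k ≫ pullback.fst _ _ = f := pullback.lift_fst _ _ _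
  have hk₂ : k ≫ pullback.snd _ _ = 0 := pullback.lift_snd _ _ _
  have hkθ : k ≫ θ = 𝟙 X := by
    rw [← cancel_mono f, Category.assoc, hθ, Preadditive.sub_comp, Preadditive.comp_sub,
      Category.assoc, reassoc_of% hk₂, Category.id_comp, hk₁]
    simp
  obtain ⟨c, hc⟩ := KernelFork.IsLimit.lift' hS.fIsKernel (f ≫ τ - k) (by
    dsimp
    rw [Preadditive.sub_comp, Category.assoc, hτ, hk₁, Category.comp_id, sub_self])
  dsimp at c hc
  refine ⟨τ ≫ θ, ?_, ?_⟩
  · have : f ≫ τ ≫ θ - 𝟙 X = (f ≫ τ - k) ≫ θ := by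
      rw [Preadditive.sub_comp, hkθ, Category.assoc]
    rw [this, ← hc, Category.assoc]
    exact .comp_of_projective hK _ _
  · have : (τ ≫ θ) ≫ f - 𝟙 Y = -((τ ≫ pullback.snd _ _) ≫ (σ ≫ pullback.fst _ _)) := by
      rw [Category.assoc, hθ, Preadditive.sub_comp, Preadditive.comp_sub, Category.id_comp, hτ]
      simp
    rw [this]
    exact (FactorsThroughProjective.comp_of_projective inferInstance _ _).neg

/-! ### Isomorphisms in the stable category -/

/-- Being a congruence, the relation coincides with equality of classes in the quotient, so inverses
can be tested on representatives. -/
instance : Congruence (stableRel A) where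
  equivalence :=
    { refl := fun f => by
        change FactorsThroughProjective _
        rw [sub_self]
        exact .zero _ _
      symm := fun {f g} (h : FactorsThroughProjective _) => by
        change FactorsThroughProjective _
        rw [← neg_sub]
        exact h.neg
      trans := fun {f g k} (h : FactorsThroughProjective _) (h' : FactorsThroughProjective _) => by
        change FactorsThroughProjective _
        rw [← sub_add_sub_cancel _ g.hom]
        exact h.add h' }
  comp_left := fun f g g' (h : FactorsThroughProjective _) => by
    change FactorsThroughProjective _
    have := h.precomp f.hom
    rwa [Preadditive.comp_sub] at this
  comp_right := fun {_ _ _ f f'} g (h : FactorsThroughProjective _) => by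
    change FactorsThroughProjective _
    have := h.postcomp g.hom
    rwa [Preadditive.sub_comp] at this

lemma isIso_stable_functor_map_iff {X Y : (gorensteinProjective A).FullSubcategory} (f : X ⟶ Y) :
    IsIso ((CategoryTheory.Quotient.functor (stableRel A)).map f) ↔ IsStableIso f.hom := by
  constructor
  · intro h
    obtain ⟨s, hs⟩ := (CategoryTheory.Quotient.functor (stableRel A)).map_surjective
      (inv ((CategoryTheory.Quotient.functor (stableRel A)).map f))
    refine ⟨s.hom, ?_, ?_⟩
    · refine (CategoryTheory.Quotient.functor_map_eq_iff (stableRel A) (f ≫ s) (𝟙 X)).1 ?_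
      rw [Functor.map_comp, hs, IsIso.hom_inv_id, CategoryTheory.Functor.map_id]
    · refine (CategoryTheory.Quotient.functor_map_eq_iff (stableRel A) (s ≫ f) (𝟙 Y)).1 ?_
      rw [Functor.map_comp, hs, IsIso.inv_hom_id, CategoryTheory.Functor.map_id]
  · rintro ⟨s, h₁, h₂⟩
    let s' : Y ⟶ X := ObjectProperty.homMk s
    refine ⟨(CategoryTheory.Quotient.functor (stableRel A)).map s', ?_, ?_⟩
    · rw [← Functor.map_comp, ← CategoryTheory.Functor.map_id]
      exact (CategoryTheory.Quotient.functor_map_eq_iff (stableRel A) (f ≫ s') (𝟙 X)).2 h₁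
    · rw [← Functor.map_comp, ← CategoryTheory.Functor.map_id]
      exact (CategoryTheory.Quotient.functor_map_eq_iff (stableRel A) (s' ≫ f) (𝟙 Y)).2 h₂

end StableIso

/-! ### The unit and counit on the stable categories -/

section

variable {A : Type u} [Category.{v} A] [Abelian A] {B : Type u'} [Category.{v'} B] [Abelian B]
  {F : A ⥤ B} {G : B ⥤ A} (adj : F ⊣ G)
  (hGP : gorensteinProjective A ≤ (gorensteinProjective B).inverseImage F)
  (hP : isProjective A ≤ (isProjective B).inverseImage F)
  (hGP' : gorensteinProjective B ≤ (gorensteinProjective A).inverseImage G)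
  (hP' : isProjective B ≤ (isProjective A).inverseImage G)

lemma gpAdj_unit_app_hom (X : (gorensteinProjective A).FullSubcategory) :
    ((gpAdj adj hGP hGP').unit.app X).hom = adj.unit.app X.obj := by
  have h := adj.map_restrictFullyFaithful_unit_app (gorensteinProjective A).fullyFaithfulι
    (gorensteinProjective B).fullyFaithfulι (L := gpMap F hGP) (R := gpMap G hGP')
    (Iso.refl _) (Iso.refl _) X
  refine h.trans ?_
  erw [G.map_id, Category.comp_id, Category.comp_id]
  rfl

lemma gpAdj_counit_app_hom (Y : (gorensteinProjective B).FullSubcategory) :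
    ((gpAdj adj hGP hGP').counit.app Y).hom = adj.counit.app Y.obj := by
  have h := adj.map_restrictFullyFaithful_counit_app (gorensteinProjective A).fullyFaithfulι
    (gorensteinProjective B).fullyFaithfulι (L := gpMap F hGP) (R := gpMap G hGP')
    (Iso.refl _) (Iso.refl _) Y
  refine h.trans ?_
  erw [F.map_id, Category.id_comp, Category.id_comp]
  rfl

variable [F.Additive] [G.Additive]

lemma isIso_stableAdj_unit_iff :
    IsIso (stableAdj adj hGP hP hGP' hP').unit ↔
      ∀ X, gorensteinProjective A X → IsStableIso (adj.unit.app X) := by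
  rw [NatTrans.isIso_iff_isIso_app]
  constructor
  · intro h X hX
    have := (isIso_stable_functor_map_iff ((gpAdj adj hGP hGP').unit.app ⟨X, hX⟩)).1 (h ⟨⟨X, hX⟩⟩)
    rwa [gpAdj_unit_app_hom] at this
  · rintro h ⟨X⟩
    refine (isIso_stable_functor_map_iff ((gpAdj adj hGP hGP').unit.app X)).2 ?_
    rw [gpAdj_unit_app_hom]
    exact h _ X.property

lemma isIso_stableAdj_counit_iff :
    IsIso (stableAdj adj hGP hP hGP' hP').counit ↔
      ∀ Y, gorensteinProjective B Y → IsStableIso (adj.counit.app Y) := by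
  rw [NatTrans.isIso_iff_isIso_app]
  constructor
  · intro h Y hY
    have := (isIso_stable_functor_map_iff
      ((gpAdj adj hGP hGP').counit.app ⟨Y, hY⟩)).1 (h ⟨⟨Y, hY⟩⟩)
    rwa [gpAdj_counit_app_hom] at this
  · rintro h ⟨Y⟩
    refine (isIso_stable_functor_map_iff ((gpAdj adj hGP hGP').counit.app Y)).2 ?_
    rw [gpAdj_counit_app_hom]
    exact h _ Y.property

/-- Faithfulness of `F` and `G` supplies the `Mono` and `Epi` instances that the criteria for stable
isomorphisms need. -/
theorem yieldsEquivalences_stableAdj_iff [EnoughProjectives A] [F.Faithful] [G.Faithful] :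
    YieldsEquivalences (stableAdj adj hGP hP hGP' hP') ↔
      (∀ X : A, gorensteinProjective A X →
        projectiveDimension (cokernel (adj.unit.app X)) ≤ 1) ∧
      (∀ Y : B, gorensteinProjective B Y → Projective (kernel (adj.counit.app Y))) := by
  refine and_congr ((isIso_stableAdj_unit_iff adj hGP hP hGP' hP').trans
    (forall₂_congr fun X hX => ?_)) ((isIso_stableAdj_counit_iff adj hGP hP hGP' hP').trans
    (forall₂_congr fun Y hY => ?_))
  · refine Iff.trans ?_ (projectiveDimension_le_iff _ 1).symm
    exact ⟨hasProjectiveDimensionLE_cokernel_of_isStableIso _ hX,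
      isStableIso_of_hasProjectiveDimensionLE_cokernel _ (hGP' _ (hGP _ hX))⟩
  · exact ⟨projective_kernel_of_isStableIso _, isStableIso_of_projective_kernel _ hY⟩

end

end

/-! ### Mapping cones, stupid filtration and devissage -/

section

open Pretriangulated

variable {A : Type u} [Category.{v} A] [Abelian A]

lemma isStrictlyLE_mappingCone {K L : CochainComplex A ℤ} (f : K ⟶ L) (b : ℤ)
    [K.IsStrictlyLE b] [L.IsStrictlyLE b] : (CochainComplex.mappingCone f).IsStrictlyLE b := by
  rw [CochainComplex.isStrictlyLE_iff]
  intro i hi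
  apply HomologicalComplex.homotopyCofiber.isZero_X f
  · exact L.isZero_of_isStrictlyLE b i
  · intro j (hj : i + 1 = j)
    exact K.isZero_of_isStrictlyLE b j

lemma isStrictlyGE_mappingCone {K L : CochainComplex A ℤ} (f : K ⟶ L) (a : ℤ)
    [K.IsStrictlyGE a] [L.IsStrictlyGE a] :
    (CochainComplex.mappingCone f).IsStrictlyGE (a - 1) := by
  rw [CochainComplex.isStrictlyGE_iff]
  intro i hi
  apply HomologicalComplex.homotopyCofiber.isZero_X f
  · exact L.isZero_of_isStrictlyGE a i
  · intro j (hj : i + 1 = j)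
    exact K.isZero_of_isStrictlyGE a j

lemma mappingCone_X_mem (𝒞 : ObjectProperty A) [𝒞.IsClosedUnderIsomorphisms]
    (h𝒞 : ∀ X Y, 𝒞 X → 𝒞 Y → 𝒞 (X ⊞ Y)) {K L : CochainComplex A ℤ} (f : K ⟶ L)
    (hK : ∀ i, 𝒞 (K.X i)) (hL : ∀ i, 𝒞 (L.X i)) (i : ℤ) :
    𝒞 ((CochainComplex.mappingCone f).X i) :=
  𝒞.prop_of_iso (HomologicalComplex.homotopyCofiber.XIsoBiprod f i (i + 1) rfl).symm
    (h𝒞 _ _ (hK _) (hL _))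

/-- The stupid filtration: if `K` is concentrated in degrees `≤ b`, then `Kᵇ` placed in degree `b`
is a subcomplex. -/
def singleToComplex (K : CochainComplex A ℤ) (b : ℤ) [K.IsStrictlyLE b] :
    (CochainComplex.singleFunctor A b).obj (K.X b) ⟶ K :=
  HomologicalComplex.mkHomFromSingle (𝟙 (K.X b)) (fun k hk => by
    have : b + 1 = k := hk
    exact (K.isZero_of_isStrictlyLE b k).eq_of_tgt _ _)

lemma isIso_singleToComplex_f (K : CochainComplex A ℤ) (b : ℤ) [K.IsStrictlyLE b] :
    IsIso ((singleToComplex K b).f b) := by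
  rw [singleToComplex, HomologicalComplex.mkHomFromSingle_f]
  have : IsIso ((HomologicalComplex.singleObjXSelf (ComplexShape.up ℤ) b (K.X b)).hom ≫
    𝟙 (K.X b)) := inferInstance
  exact this

instance mono_singleToComplex (K : CochainComplex A ℤ) (b : ℤ) [K.IsStrictlyLE b] :
    Mono (singleToComplex K b) := by
  apply HomologicalComplex.mono_of_mono_f
  intro i
  by_cases hi : i = b
  · subst hi
    have := isIso_singleToComplex_f K i
    infer_instance
  · have h : IsZero (((CochainComplex.singleFunctor A b).obj (K.X b)).X i) :=
      HomologicalComplex.isZero_single_obj_X _ _ _ _ hi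
    exact ⟨fun _ _ _ => h.eq_of_tgt _ _⟩

lemma isZero_cokernel_singleToComplex_X (K : CochainComplex A ℤ) (b : ℤ) [K.IsStrictlyLE b] :
    IsZero ((cokernel (singleToComplex K b)).X b) := by
  have := isIso_singleToComplex_f K b
  have h : (singleToComplex K b).f b ≫ (cokernel.π (singleToComplex K b)).f b = 0 := by
    rw [← HomologicalComplex.comp_f, cokernel.condition, HomologicalComplex.zero_f]
  have h' : (cokernel.π (singleToComplex K b)).f b = 0 := by
    rw [← cancel_epi ((singleToComplex K b).f b), h, comp_zero]
  have : Epi ((cokernel.π (singleToComplex K b)).f b) := inferInstance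
  rw [IsZero.iff_id_eq_zero, ← cancel_epi ((cokernel.π (singleToComplex K b)).f b), h']
  simp

lemma isIso_cokernel_π_singleToComplex_f (K : CochainComplex A ℤ) (b : ℤ) [K.IsStrictlyLE b]
    (i : ℤ) (hi : i ≠ b) : IsIso ((cokernel.π (singleToComplex K b)).f i) := by
  have hS := (shortExact_cokernel (singleToComplex K b)).map_of_exact
    (HomologicalComplex.eval A (ComplexShape.up ℤ) i)
  have h : IsZero (((CochainComplex.singleFunctor A b).obj (K.X b)).X i) :=
    HomologicalComplex.isZero_single_obj_X _ _ _ _ hi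
  exact hS.isIso_g_iff.2 h

lemma exists_truncation_shortExact (K : CochainComplex A ℤ) (b : ℤ) [K.IsStrictlyLE b] :
    ∃ (L : CochainComplex A ℤ) (p : K ⟶ L) (w : singleToComplex K b ≫ p = 0),
      (ShortComplex.mk (singleToComplex K b) p w).ShortExact ∧ IsZero (L.X b) ∧
      ∀ i, i ≠ b → Nonempty (L.X i ≅ K.X i) :=
  ⟨cokernel (singleToComplex K b), cokernel.π _, cokernel.condition _, shortExact_cokernel _,
    isZero_cokernel_singleToComplex_X K b, fun i hi =>
      have := isIso_cokernel_π_singleToComplex_f K b i hi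
      ⟨(asIso ((cokernel.π (singleToComplex K b)).f i)).symm⟩⟩

variable [HasDerivedCategory.{w} A]

open DerivedCategory

/-- Devissage: a class of objects of the derived category which is closed under extensions
contains a bounded complex as soon as it contains its components. -/
lemma Q_obj_mem_of_single_mem (𝒯 : ObjectProperty (DerivedCategory A))
    [𝒯.IsClosedUnderIsomorphisms] [𝒯.ContainsZero] [𝒯.IsTriangulatedClosed₂]
    (K : CochainComplex A ℤ) (a b : ℤ) (ha : K.IsStrictlyGE a) (hb : K.IsStrictlyLE b)
    (h : ∀ i, 𝒯 ((singleFunctor A i).obj (K.X i))) : 𝒯 (Q.obj K) := by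
  obtain ⟨n, hn⟩ : ∃ n : ℕ, b < a + n := ⟨(b - a + 1).toNat, by lia⟩
  induction n generalizing K b with
  | zero =>
    refine 𝒯.prop_of_isZero (Q.map_isZero ?_)
    rw [IsZero.iff_id_eq_zero]
    ext i
    by_cases hi : i < a
    · exact (K.isZero_of_isStrictlyGE a i).eq_of_src _ _
    · exact (K.isZero_of_isStrictlyLE b i).eq_of_src _ _
  | succ n hn' =>
    -- Splitting off the top term `Kᵇ` leaves a complex in degrees `[a, b - 1]`.
    obtain ⟨L, p, w, hS, hL, hL'⟩ := exists_truncation_shortExact K b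
    have hT := triangleOfSES_distinguished hS
    refine 𝒯.ext_of_isTriangulatedClosed₂ _ hT (h b) ?_
    refine hn' L (b - 1) ?_ ?_ (fun i => ?_) (by lia)
    · rw [CochainComplex.isStrictlyGE_iff]
      intro i hi
      by_cases hib : i = b
      · rwa [hib]
      · obtain ⟨e⟩ := hL' i hib
        exact (K.isZero_of_isStrictlyGE a i).of_iso e
    · rw [CochainComplex.isStrictlyLE_iff]
      intro i hi
      by_cases hib : i = b
      · rwa [hib]
      · obtain ⟨e⟩ := hL' i hib
        exact (K.isZero_of_isStrictlyLE b i).of_iso e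
    · by_cases hib : i = b
      · subst hib
        exact 𝒯.prop_of_isZero ((singleFunctor A i).map_isZero hL)
      · obtain ⟨e⟩ := hL' i hib
        exact 𝒯.prop_of_iso ((singleFunctor A i).mapIso e.symm) (h i)

/-- From a K-projective source, morphisms in the derived and homotopy categories agree, and the
latter lift to chain maps. -/
lemma exists_Q_map_eq {K L : CochainComplex A ℤ} [K.IsKProjective] (φ : Q.obj K ⟶ Q.obj L) :
    ∃ f : K ⟶ L, Q.map f = φ := by
  obtain ⟨g, hg⟩ := (CochainComplex.IsKProjective.Qh_map_bijective K
    ((HomotopyCategory.quotient A (ComplexShape.up ℤ)).obj L)).surjective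
    ((quotientCompQhIso A).hom.app K ≫ φ ≫ (quotientCompQhIso A).inv.app L)
  obtain ⟨f, rfl⟩ := (HomotopyCategory.quotient A (ComplexShape.up ℤ)).map_surjective g
  refine ⟨f, ?_⟩
  have h := quotientCompQhIso_hom_naturality f
  rw [hg] at h
  simpa using h.symm

lemma nonempty_iso_mappingCone {T : Triangle (DerivedCategory A)} (hT : T ∈ distTriang _)
    {K L : CochainComplex A ℤ} (f : K ⟶ L) (e₁ : T.obj₁ ≅ Q.obj K) (e₂ : T.obj₂ ≅ Q.obj L)
    (comm : T.mor₁ ≫ e₂.hom = e₁.hom ≫ Q.map f) :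
    Nonempty (T.obj₃ ≅ Q.obj (CochainComplex.mappingCone f)) :=
  ⟨Triangle.π₃.mapIso (isoTriangleOfIso₁₂ _ _ hT (mappingCone_triangle_distinguished f) e₁ e₂ comm)⟩

end

section

open Pretriangulated DerivedCategory

open scoped ZeroObject

variable {A : Type u} [Category.{v} A] [Abelian A]

instance : (isProjective A).IsClosedUnderIsomorphisms where
  of_iso e h := Projective.of_iso e h

/-! ### Bounded above complexes of projective objects -/

/-- A bounded above complex of projective objects. -/
structure IsMinusProjective (P : CochainComplex A ℤ) : Prop where
  isStrictlyLE : ∃ b, P.IsStrictlyLE b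
  projective (i : ℤ) : Projective (P.X i)

namespace IsMinusProjective

lemma isKProjective {P : CochainComplex A ℤ} (hP : IsMinusProjective P) : P.IsKProjective := by
  obtain ⟨b, hb⟩ := hP.isStrictlyLE
  have := hP.projective
  exact CochainComplex.isKProjective_of_projective P b

lemma mappingCone {P R : CochainComplex A ℤ} (hP : IsMinusProjective P)
    (hR : IsMinusProjective R) (f : P ⟶ R) :
    IsMinusProjective (CochainComplex.mappingCone f) where
  isStrictlyLE := by
    obtain ⟨b, hb⟩ := hP.isStrictlyLE
    obtain ⟨b', hb'⟩ := hR.isStrictlyLE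
    have := P.isStrictlyLE_of_le b (max b b') (by simp)
    have := R.isStrictlyLE_of_le b' (max b b') (by simp)
    exact ⟨max b b', isStrictlyLE_mappingCone f _⟩
  projective := mappingCone_X_mem (isProjective A) (fun X Y (_ : Projective X) (_ : Projective Y) =>
    (inferInstance : Projective (X ⊞ Y))) f hP.projective hR.projective

lemma shift {P : CochainComplex A ℤ} (hP : IsMinusProjective P) (n : ℤ) :
    IsMinusProjective (P⟦n⟧) where
  isStrictlyLE := by
    obtain ⟨b, hb⟩ := hP.isStrictlyLE
    exact ⟨b - n, P.isStrictlyLE_shift b n (b - n) (by lia)⟩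
  projective i := hP.projective (i + n)

lemma biprod {P R : CochainComplex A ℤ} (hP : IsMinusProjective P)
    (hR : IsMinusProjective R) : IsMinusProjective (P ⊞ R) where
  isStrictlyLE := by
    obtain ⟨b, hb⟩ := hP.isStrictlyLE
    obtain ⟨b', hb'⟩ := hR.isStrictlyLE
    refine ⟨max b b', ?_⟩
    rw [CochainComplex.isStrictlyLE_iff]
    intro i hi
    have h₁ := P.isZero_of_isStrictlyLE b i (by lia)
    have h₂ := R.isZero_of_isStrictlyLE b' i (by lia)
    exact IsZero.of_iso ((biprod_isZero_iff _ _).2 ⟨h₁, h₂⟩)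
      (HomologicalComplex.biprodXIso P R i)
  projective i := by
    have := hP.projective i
    have := hR.projective i
    exact Projective.of_iso (HomologicalComplex.biprodXIso P R i).symm inferInstance

end IsMinusProjective

lemma isMinusProjective_cochainComplex {X : A} (R : ProjectiveResolution X) :
    IsMinusProjective R.cochainComplex where
  isStrictlyLE := ⟨0, inferInstance⟩
  projective _ := inferInstance

variable [HasDerivedCategory.{w} A]

variable (A) in
/-- The objects of the derived category which are isomorphic to a bounded above complex of
projective objects. -/
def hasProjectiveModel : ObjectProperty (DerivedCategory A) := fun X =>
  ∃ P : CochainComplex A ℤ, IsMinusProjective P ∧ Nonempty (X ≅ Q.obj P)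

instance : (hasProjectiveModel A).IsClosedUnderIsomorphisms where
  of_iso := by
    rintro X Y e ⟨P, hP, ⟨e'⟩⟩
    exact ⟨P, hP, ⟨e.symm ≪≫ e'⟩⟩

instance : (hasProjectiveModel A).IsStableUnderShift ℤ where
  isStableUnderShiftBy n :=
    { le_shift := by
        rintro X ⟨P, hP, ⟨e⟩⟩
        exact ⟨P⟦n⟧, hP.shift n, ⟨(shiftFunctor _ n).mapIso e ≪≫ ((Q.commShiftIso n).app P).symm⟩⟩ }

instance : (hasProjectiveModel A).ContainsZero where
  exists_zero := ⟨Q.obj (0 : CochainComplex A ℤ), Q.map_isZero (isZero_zero _), 0,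
    ⟨⟨0, by
        rw [CochainComplex.isStrictlyLE_iff]
        intro i _
        exact (HomologicalComplex.eval A (ComplexShape.up ℤ) i).map_isZero (isZero_zero _)⟩,
      fun i => ((HomologicalComplex.eval A (ComplexShape.up ℤ) i).map_isZero
        (isZero_zero _)).projective⟩, ⟨Iso.refl _⟩⟩

instance : (hasProjectiveModel A).IsTriangulatedClosed₃ := .mk' (by
  rintro T hT ⟨P, hP, ⟨e⟩⟩ ⟨R, hR, ⟨e'⟩⟩
  have := hP.isKProjective
  obtain ⟨f, hf⟩ := exists_Q_map_eq (e.inv ≫ T.mor₁ ≫ e'.hom)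
  obtain ⟨e''⟩ := nonempty_iso_mappingCone hT f e e' (by simp [hf])
  exact ⟨_, hP.mappingCone hR f, ⟨e''⟩⟩)

instance : (hasProjectiveModel A).IsTriangulatedClosed₂ :=
  .of_isTriangulatedClosed₃

variable [EnoughProjectives A]

lemma hasProjectiveModel_singleFunctor (X : A) (n : ℤ) :
    hasProjectiveModel A ((singleFunctor A n).obj X) := by
  have h : hasProjectiveModel A ((singleFunctor A 0).obj X) := by
    let R := projectiveResolution X
    exact ⟨R.cochainComplex, isMinusProjective_cochainComplex R,
      ⟨(singleFunctorIsoCompQ A 0).app X ≪≫ (asIso (Q.map R.π')).symm⟩⟩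
  refine (hasProjectiveModel A).prop_of_iso
    (((singleFunctors A).shiftIso (-n) n 0 (by simp)).app X) ?_
  exact (hasProjectiveModel A).le_shift (-n) _ h

lemma hasProjectiveModel_of_bounded {X : DerivedCategory A}
    (hX : (TStructure.t : Triangulated.TStructure (DerivedCategory A)).bounded X) :
    hasProjectiveModel A X := by
  obtain ⟨⟨a, ha⟩, ⟨b, hb⟩⟩ := hX
  obtain ⟨K, hK, hK', ⟨e⟩⟩ := exists_iso_Q_obj_of_isGE_of_isLE X a b
  exact (hasProjectiveModel A).prop_of_iso e.symm
    (Q_obj_mem_of_single_mem _ K a b hK hK' (fun i => hasProjectiveModel_singleFunctor _ _))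

end

section

open Pretriangulated DerivedCategory

variable {A : Type u} [Category.{v} A] [Abelian A]

/-! ### Resolving classes of objects -/

/-- A class of objects which contains the projective objects and which is closed under direct sums,
direct summands and kernels of epimorphisms. -/
structure IsResolving (𝒞 : ObjectProperty A) : Prop where
  of_projective {P : A} (hP : Projective P) : 𝒞 P
  biprod (X Y : A) (hX : 𝒞 X) (hY : 𝒞 Y) : 𝒞 (X ⊞ Y)
  of_retract {X Y : A} (r : Retract X Y) (hY : 𝒞 Y) : 𝒞 X
  X₁ {S : ShortComplex A} (hS : S.ShortExact) (h₂ : 𝒞 S.X₂) (h₃ : 𝒞 S.X₃) : 𝒞 S.X₁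

lemma IsResolving.of_iso {𝒞 : ObjectProperty A} (h𝒞 : IsResolving 𝒞) {X Y : A} (e : X ≅ Y)
    (hX : 𝒞 X) : 𝒞 Y :=
  h𝒞.of_retract e.symm.retract hX

lemma IsResolving.of_isZero {𝒞 : ObjectProperty A} (h𝒞 : IsResolving 𝒞) {X : A} (hX : IsZero X) :
    𝒞 X :=
  h𝒞.of_projective hX.projective

lemma IsResolving.isClosedUnderIsomorphisms {𝒞 : ObjectProperty A} (h𝒞 : IsResolving 𝒞) :
    𝒞.IsClosedUnderIsomorphisms where
  of_iso := h𝒞.of_iso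

lemma isResolving_isProjective : IsResolving (isProjective A) where
  of_projective hP := hP
  biprod X Y (hX : Projective X) (hY : Projective Y) := (inferInstance : Projective (X ⊞ Y))
  of_retract r (hY : Projective _) := r.projective
  X₁ {S} hS h₂ (h₃ : Projective S.X₃) := by
    have : Projective S.X₂ := h₂
    exact Retract.projective (Y := S.X₂) ⟨S.f, hS.splittingOfProjective.r,
      hS.splittingOfProjective.f_r⟩

lemma isResolving_gorensteinProjective [EnoughProjectives A] :
    IsResolving (gorensteinProjective A) where
  of_projective := gorensteinProjective_of_projective
  biprod _ _ := gorensteinProjective_biprod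
  of_retract := gorensteinProjective_of_retract
  X₁ := gorensteinProjective_X₁

/-! ### Opcycles of complexes -/

/-- The short complex `Kⁱ/Bⁱ ⟶ Kʲ ⟶ Kʲ/Bʲ` for `i + 1 = j`. -/
abbrev opcyclesShortComplex (K : CochainComplex A ℤ) (i j : ℤ) : ShortComplex A :=
  ShortComplex.mk (K.fromOpcycles i j) (K.pOpcycles j) (by
    rw [← cancel_epi (K.pOpcycles i)]
    simp)

lemma opcyclesShortComplex_shortExact {K : CochainComplex A ℤ} (i j : ℤ) (hij : i + 1 = j)
    (hK : K.ExactAt i) : (opcyclesShortComplex K i j).ShortExact where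
  exact := by
    apply ShortComplex.exact_of_g_is_cokernel
    exact CokernelCofork.IsColimit.ofπ' _ _ (fun {T} k hk =>
      ⟨K.descOpcycles k i (by simp; lia) (by
        rw [← K.p_fromOpcycles i j, Category.assoc, hk, comp_zero]), by simp⟩)
  mono_f := by
    rw [HomologicalComplex.exactAt_iff] at hK
    have := hK.mono_fromOpcycles
    obtain rfl : j = (ComplexShape.up ℤ).next i := by simp; lia
    exact this
  epi_g := by dsimp; infer_instance

lemma isZero_opcycles {K : CochainComplex A ℤ} {i : ℤ} (h : IsZero (K.X i)) :
    IsZero (K.opcycles i) := by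
  rw [IsZero.iff_id_eq_zero, ← cancel_epi (K.pOpcycles i)]
  exact h.eq_of_src _ _

/-- Descending induction from above degree `b`, where the opcycles vanish, using closure under
kernels of epimorphisms. -/
lemma opcycles_mem_of_acyclic {𝒞 : ObjectProperty A} (h𝒞 : IsResolving 𝒞)
    {K : CochainComplex A ℤ} (hK : K.Acyclic) (b : ℤ) (hb : K.IsStrictlyLE b)
    (h : ∀ i, 𝒞 (K.X i)) (i : ℤ) : 𝒞 (K.opcycles i) := by
  obtain ⟨n, hn⟩ : ∃ n : ℕ, b < i + n := ⟨(b - i + 1).toNat, by lia⟩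
  induction n generalizing i with
  | zero => exact h𝒞.of_isZero (isZero_opcycles (K.isZero_of_isStrictlyLE b i))
  | succ n hn' =>
    exact h𝒞.X₁ (opcyclesShortComplex_shortExact i (i + 1) rfl (hK i)) (h _)
      (hn' (i + 1) (by lia))

/-- The opcycles of a shifted complex. -/
def shiftOpcyclesIso (K : CochainComplex A ℤ) (n i i' : ℤ) (hi : n + i = i') :
    HomologicalComplex.opcycles (K⟦n⟧) i ≅ K.opcycles i' :=
  ShortComplex.opcyclesMapIso ((CochainComplex.shiftShortComplexFunctorIso A n i i' hi).app K)

lemma isIso_opcyclesMap {K L : CochainComplex A ℤ} (f : K ⟶ L) (i j : ℤ) (hij : i + 1 = j)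
    [Epi (f.f i)] [IsIso (f.f j)] : IsIso (HomologicalComplex.opcyclesMap f j) := by
  obtain rfl : i = (ComplexShape.up ℤ).prev j := by simp; lia
  exact ShortComplex.isIso_opcyclesMap_of_isIso_of_epi'
    ((HomologicalComplex.shortComplexFunctor A (ComplexShape.up ℤ) j).map f) ‹_› ‹_›

/-- Where `L` vanishes, the cone is just the shift of `K`, and the projection is inverse to the
inclusion up to sign. -/
lemma isIso_triangle_mor₃_f {K L : CochainComplex A ℤ} (f : K ⟶ L) (i : ℤ)
    (hi : IsZero (L.X i)) : IsIso ((CochainComplex.mappingCone.triangle f).mor₃.f i) := by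
  have h₁ := CochainComplex.mappingCone.inl_v_triangle_mor₃_f f (i + 1) i (by simp)
  have h₂ := CochainComplex.mappingCone.id_X f i (i + 1) rfl
  rw [hi.eq_of_src ((CochainComplex.mappingCone.inr f).f i) 0, comp_zero, add_zero] at h₂
  have h₃ := CochainComplex.mappingCone.inl_v_fst_v f (i + 1) i rfl
  have : IsIso ((CochainComplex.mappingCone.inl f).v (i + 1) i (by simp)) := ⟨_, h₃, h₂⟩
  have : IsIso ((CochainComplex.mappingCone.inl f).v (i + 1) i (by simp) ≫
      (CochainComplex.mappingCone.triangle f).mor₃.f i) := by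
    rw [h₁]
    exact ⟨-(K.shiftFunctorObjXIso 1 i (i + 1) rfl).hom,
      (Preadditive.neg_comp_neg _ _).trans (Iso.inv_hom_id _),
      (Preadditive.neg_comp_neg _ _).trans (Iso.hom_inv_id _)⟩
  exact IsIso.of_isIso_comp_left ((CochainComplex.mappingCone.inl f).v (i + 1) i _) _

section

variable [HasDerivedCategory.{w} A]

lemma acyclic_mappingCone {K L : CochainComplex A ℤ} (f : K ⟶ L) [IsIso (Q.map f)] :
    (CochainComplex.mappingCone f).Acyclic := by
  have h : IsZero (Q.obj (CochainComplex.mappingCone f)) :=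
    (Triangle.isZero₃_iff_isIso₁ _ (mappingCone_triangle_distinguished f)).2 ‹_›
  intro i
  rw [HomologicalComplex.exactAt_iff_isZero_homology]
  exact ((homologyFunctor A i).map_isZero h).of_iso ((homologyFunctorFactors A i).app _).symm

/-- The objects of the derived category which are isomorphic to a bounded complex with all
components in `𝒞`. -/
def complexesOf (𝒞 : ObjectProperty A) : ObjectProperty (DerivedCategory A) := fun X =>
  ∃ (K : CochainComplex A ℤ) (a b : ℤ), K.IsStrictlyGE a ∧ K.IsStrictlyLE b ∧
    (∀ i, 𝒞 (K.X i)) ∧ Nonempty (X ≅ Q.obj K)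

lemma complexesOf_le_bounded (𝒞 : ObjectProperty A) :
    complexesOf 𝒞 ≤ (TStructure.t : Triangulated.TStructure (DerivedCategory A)).bounded := by
  rintro X ⟨K, a, b, ha, hb, -, ⟨e⟩⟩
  exact ⟨⟨a, TStructure.t.isGE_of_iso e.symm a⟩, ⟨b, TStructure.t.isLE_of_iso e.symm b⟩⟩

variable {𝒞 : ObjectProperty A} (h𝒞 : IsResolving 𝒞)

include h𝒞

/-- A quasi-isomorphism from `P` to a bounded complex `M` in `𝒞` has an acyclic bounded above cone
with terms in `𝒞`, so the opcycles of the cone lie in `𝒞`. Below `M`, this cone is `P⟦1⟧`. -/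
lemma exists_opcycles_mem {P : CochainComplex A ℤ} (hP : IsMinusProjective P)
    (h : complexesOf 𝒞 (Q.obj P)) : ∃ a : ℤ, ∀ n ≤ a, 𝒞 (P.opcycles n) := by
  obtain ⟨M, a, b, ha, hb, hM, ⟨e⟩⟩ := h
  have := hP.isKProjective
  obtain ⟨f, hf⟩ := exists_Q_map_eq e.hom
  have : IsIso (Q.map f) := by rw [hf]; infer_instance
  obtain ⟨b', hb'⟩ := hP.isStrictlyLE
  have := P.isStrictlyLE_of_le b' (max b b') (by simp)
  have := M.isStrictlyLE_of_le b (max b b') (by simp)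
  have := h𝒞.isClosedUnderIsomorphisms
  have hC := opcycles_mem_of_acyclic h𝒞 (acyclic_mappingCone f) (max b b')
    (isStrictlyLE_mappingCone f _)
    (mappingCone_X_mem 𝒞 h𝒞.biprod f (fun i => h𝒞.of_projective (hP.projective i)) hM)
  refine ⟨a, fun n hn => ?_⟩
  -- Opcycles involve the incoming differential, so two consecutive degrees are needed.
  have := isIso_triangle_mor₃_f f (n - 1) (M.isZero_of_isStrictlyGE a _)
  have := isIso_triangle_mor₃_f f (n - 1 - 1) (M.isZero_of_isStrictlyGE a _)
  have := isIso_opcyclesMap (CochainComplex.mappingCone.triangle f).mor₃ (n - 1 - 1) (n - 1)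
    (by simp)
  exact h𝒞.of_iso (asIso (HomologicalComplex.opcyclesMap
    (CochainComplex.mappingCone.triangle f).mor₃ (n - 1)) ≪≫
      shiftOpcyclesIso P 1 (n - 1) n (by simp)) (hC (n - 1))

omit [HasDerivedCategory.{w} A] in
lemma truncGE_X_mem {P : CochainComplex A ℤ} (hP : IsMinusProjective P) (n : ℤ)
    (h : 𝒞 (P.opcycles n)) (i : ℤ) : 𝒞 ((P.truncGE n).X i) := by
  obtain hi | rfl | hi := lt_trichotomy i n
  · exact h𝒞.of_isZero (CochainComplex.isZero_of_isStrictlyGE _ n i)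
  · exact h𝒞.of_iso (P.truncGEXIsoOpcycles i).symm h
  · exact h𝒞.of_iso (P.truncGEXIso n i hi).symm (h𝒞.of_projective (hP.projective i))

/-- The canonical truncation of `P` at `n` is quasi-isomorphic to `P`, and its only possibly
nonprojective term is `P.opcycles n`. -/
lemma complexesOf_of_opcycles_mem {P : CochainComplex A ℤ} (hP : IsMinusProjective P) (n : ℤ)
    [P.IsGE n] (h : 𝒞 (P.opcycles n)) : complexesOf 𝒞 (Q.obj P) := by
  obtain ⟨b, hb⟩ := hP.isStrictlyLE
  exact ⟨P.truncGE n, n, b, inferInstance, inferInstance, truncGE_X_mem h𝒞 hP n h,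
    ⟨asIso (Q.map (P.πTruncGE n))⟩⟩

end

end

section

open Pretriangulated DerivedCategory

open scoped ZeroObject

variable {A : Type u} [Category.{v} A] [Abelian A] [HasDerivedCategory.{w} A]

/-! ### The triangulated subcategory attached to a resolving class -/

instance (𝒞 : ObjectProperty A) : (complexesOf 𝒞).IsClosedUnderIsomorphisms where
  of_iso := by
    rintro X Y e ⟨K, a, b, ha, hb, hK, ⟨e'⟩⟩
    exact ⟨K, a, b, ha, hb, hK, ⟨e.symm ≪≫ e'⟩⟩

instance (𝒞 : ObjectProperty A) : (complexesOf 𝒞).IsStableUnderShift ℤ where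
  isStableUnderShiftBy n :=
    { le_shift := by
        rintro X ⟨K, a, b, ha, hb, hK, ⟨e⟩⟩
        exact ⟨K⟦n⟧, a - n, b - n, K.isStrictlyGE_shift a n (a - n) (by lia),
          K.isStrictlyLE_shift b n (b - n) (by lia), fun i => hK (i + n),
          ⟨(shiftFunctor _ n).mapIso e ≪≫ ((Q.commShiftIso n).app K).symm⟩⟩ }

lemma exists_forall_isGE {X : DerivedCategory A} {P : CochainComplex A ℤ} (e : X ≅ Q.obj P)
    (hX : (TStructure.t : Triangulated.TStructure (DerivedCategory A)).bounded X) :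
    ∃ a : ℤ, ∀ n ≤ a, P.IsGE n := by
  obtain ⟨⟨a, ha⟩, -⟩ := hX
  refine ⟨a, fun n hn => ?_⟩
  have : P.IsGE a := (isGE_Q_obj_iff P a).1 (TStructure.t.isGE_of_iso e a)
  exact P.isGE_of_ge n a hn

variable [EnoughProjectives A]

lemma exists_projective_model {X : DerivedCategory A}
    (hX : (TStructure.t : Triangulated.TStructure (DerivedCategory A)).bounded X) :
    ∃ (P : CochainComplex A ℤ) (_ : IsMinusProjective P) (_ : X ≅ Q.obj P) (a : ℤ),
      ∀ n ≤ a, P.IsGE n := by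
  obtain ⟨P, hP, ⟨e⟩⟩ := hasProjectiveModel_of_bounded hX
  obtain ⟨a, ha⟩ := exists_forall_isGE e hX
  exact ⟨P, hP, e, a, ha⟩

variable {𝒞 : ObjectProperty A}

namespace IsResolving

variable (h𝒞 : IsResolving 𝒞)

include h𝒞

omit [EnoughProjectives A] in
lemma complexesOf_containsZero : (complexesOf 𝒞).ContainsZero where
  exists_zero := by
    have h (i : ℤ) : IsZero ((0 : CochainComplex A ℤ).X i) :=
      (HomologicalComplex.eval A (ComplexShape.up ℤ) i).map_isZero (isZero_zero _)
    exact ⟨Q.obj (0 : CochainComplex A ℤ), Q.map_isZero (isZero_zero _), 0, 0, 0,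
      (CochainComplex.isStrictlyGE_iff _ _).2 fun i _ => h i,
      (CochainComplex.isStrictlyLE_iff _ _).2 fun i _ => h i, fun i => h𝒞.of_isZero (h i),
      ⟨Iso.refl _⟩⟩

/-- A morphism in the derived category need not be a chain map between the given complexes. It is
one between projective models, and both models may be truncated at one sufficiently low degree
without leaving `𝒞`; the cone of the truncated map does the job. -/
lemma complexesOf_isTriangulatedClosed₃ : (complexesOf 𝒞).IsTriangulatedClosed₃ := .mk' (by
  intro T hT h₁ h₂
  obtain ⟨P, hP, e, a, ha⟩ := exists_projective_model (complexesOf_le_bounded _ _ h₁)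
  obtain ⟨R, hR, e', a', ha'⟩ := exists_projective_model (complexesOf_le_bounded _ _ h₂)
  obtain ⟨c, hc⟩ := exists_opcycles_mem h𝒞 hP ((complexesOf 𝒞).prop_of_iso e h₁)
  obtain ⟨c', hc'⟩ := exists_opcycles_mem h𝒞 hR ((complexesOf 𝒞).prop_of_iso e' h₂)
  have := hP.isKProjective
  obtain ⟨f, hf⟩ := exists_Q_map_eq (e.inv ≫ T.mor₁ ≫ e'.hom)
  obtain ⟨n, hn₁, hn₂, hn₃, hn₄⟩ : ∃ n : ℤ, n ≤ a ∧ n ≤ a' ∧ n ≤ c ∧ n ≤ c' :=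
    ⟨min (min a a') (min c c'), by simp, by simp, by simp, by simp⟩
  have := ha n hn₁
  have := ha' n hn₂
  obtain ⟨e''⟩ := nonempty_iso_mappingCone hT (CochainComplex.truncGEMap f n)
    (e ≪≫ asIso (Q.map (P.πTruncGE n))) (e' ≪≫ asIso (Q.map (R.πTruncGE n))) (by
      dsimp
      rw [Category.assoc, ← Q.map_comp, CochainComplex.πTruncGE_naturality, Q.map_comp, hf]
      simp)
  obtain ⟨b, hb⟩ := hP.isStrictlyLE
  obtain ⟨b', hb'⟩ := hR.isStrictlyLE
  have := P.isStrictlyLE_of_le b (max b b') (by simp)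
  have := R.isStrictlyLE_of_le b' (max b b') (by simp)
  have := h𝒞.isClosedUnderIsomorphisms
  exact ⟨_, n - 1, max b b', isStrictlyGE_mappingCone _ _, isStrictlyLE_mappingCone _ _,
    mappingCone_X_mem 𝒞 h𝒞.biprod _ (truncGE_X_mem h𝒞 hP n (hc n hn₃))
      (truncGE_X_mem h𝒞 hR n (hc' n hn₄)), ⟨e''⟩⟩)

lemma complexesOf_isTriangulated : (complexesOf 𝒞).IsTriangulated := by
  have := h𝒞.complexesOf_containsZero
  have := h𝒞.complexesOf_isTriangulatedClosed₃
  have : (complexesOf 𝒞).IsTriangulatedClosed₂ := .of_isTriangulatedClosed₃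
  exact { }

/-- On projective models, the opcycles of a summand are a retract of those of the sum. -/
lemma complexesOf_of_biprod {X Y : DerivedCategory A}
    (hX : (TStructure.t : Triangulated.TStructure (DerivedCategory A)).bounded X)
    (hY : (TStructure.t : Triangulated.TStructure (DerivedCategory A)).bounded Y)
    (h : complexesOf 𝒞 (X ⊞ Y)) : complexesOf 𝒞 X := by
  obtain ⟨P, hP, e, a, ha⟩ := exists_projective_model hX
  obtain ⟨R, hR, ⟨e'⟩⟩ := hasProjectiveModel_of_bounded hY
  have := preservesBinaryBiproduct_of_preservesBiproduct (Q : CochainComplex A ℤ ⥤ _) P R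
  obtain ⟨c, hc⟩ := exists_opcycles_mem h𝒞 (hP.biprod hR)
    ((complexesOf 𝒞).prop_of_iso (biprod.mapIso e e' ≪≫ (Q.mapBiprod P R).symm) h)
  have := ha (min a c) (by simp)
  refine (complexesOf 𝒞).prop_of_iso e.symm (complexesOf_of_opcycles_mem h𝒞 hP (min a c) ?_)
  exact h𝒞.of_retract ⟨HomologicalComplex.opcyclesMap biprod.inl (min a c),
    HomologicalComplex.opcyclesMap biprod.fst (min a c), by
      rw [← HomologicalComplex.opcyclesMap_comp, biprod.inl_fst,
        HomologicalComplex.opcyclesMap_id]⟩ (hc (min a c) (by simp))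

lemma complexesOf_obj₁_of_mor₁_eq_zero {T : Triangle (DerivedCategory A)} (hT : T ∈ distTriang _)
    (h₁ : (TStructure.t : Triangulated.TStructure (DerivedCategory A)).bounded T.obj₁)
    (h₂ : (TStructure.t : Triangulated.TStructure (DerivedCategory A)).bounded T.obj₂)
    (zero : T.mor₁ = 0) (h : complexesOf 𝒞 T.obj₃) : complexesOf 𝒞 T.obj₁ := by
  -- The rotated triangle has vanishing third morphism, so `T.obj₃` is the sum of `T.obj₂` and
  -- `T.obj₁⟦1⟧`.
  obtain ⟨e, -, -⟩ := exists_iso_binaryBiproduct_of_distTriang _ (rot_of_distTriang _ hT)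
    (by simp [zero]; rfl)
  have h' := h𝒞.complexesOf_of_biprod (ObjectProperty.le_shift _ (1 : ℤ) _ h₁) h₂
    ((complexesOf 𝒞).prop_of_iso (e ≪≫ biprod.braiding _ _) h)
  exact ((complexesOf 𝒞).prop_shift_iff_of_isStableUnderShift _ _).1 h'

end IsResolving

/-! ### Finite dimension with respect to a class of objects -/

/-- There is an exact sequence `0 ⟶ Mₙ ⟶ ⋯ ⟶ M₀ ⟶ X ⟶ 0` with all `Mᵢ` in `𝒞`. -/
def DimLE (𝒞 : ObjectProperty A) : ℕ → A → Prop
  | 0, X => 𝒞 X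
  | n + 1, X => ∃ S : ShortComplex A, S.ShortExact ∧ DimLE 𝒞 n S.X₁ ∧ 𝒞 S.X₂ ∧ Nonempty (S.X₃ ≅ X)

omit [HasDerivedCategory.{w} A] [EnoughProjectives A] in
lemma gpdLE_iff_dimLE (n : ℕ) (X : A) : GpdLE n X ↔ DimLE (gorensteinProjective A) n X := by
  induction n generalizing X with
  | zero => rfl
  | succ n hn => simp only [GpdLE, DimLE, hn]

omit [HasDerivedCategory.{w} A] in
lemma hasProjectiveDimensionLE_iff_dimLE (n : ℕ) (X : A) :
    HasProjectiveDimensionLE X n ↔ DimLE (isProjective A) n X := by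
  induction n generalizing X with
  | zero => exact (projective_iff_hasProjectiveDimensionLE_zero X).symm
  | succ n hn =>
    constructor
    · intro h
      refine ⟨_, shortExact_kernel (Projective.π X), (hn _).1 ?_, Projective.projective_over X,
        ⟨Iso.refl _⟩⟩
      exact ((shortExact_kernel (Projective.π X)).hasProjectiveDimensionLT_X₃_iff n
        (Projective.projective_over X)).1 h
    · rintro ⟨S, hS, h₁, h₂, ⟨e⟩⟩
      have := (hS.hasProjectiveDimensionLT_X₃_iff n h₂).2 ((hn _).2 h₁)
      exact hasProjectiveDimensionLT_of_iso e _

omit [HasDerivedCategory.{w} A] [EnoughProjectives A] in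
lemma DimLE.of_iso (h𝒞 : IsResolving 𝒞) {n : ℕ} {X Y : A} (e : X ≅ Y) (h : DimLE 𝒞 n X) :
    DimLE 𝒞 n Y := by
  cases n with
  | zero => exact h𝒞.of_iso e h
  | succ n =>
    obtain ⟨S, hS, h₁, h₂, ⟨e'⟩⟩ := h
    exact ⟨S, hS, h₁, h₂, ⟨e' ≪≫ e⟩⟩

-- Below degree `a` the complex is exact, so its terms from `i + 1` to `j` resolve `P.opcycles j`
-- with `P.opcycles i` as last syzygy.
omit [HasDerivedCategory.{w} A] [EnoughProjectives A] in
lemma dimLE_opcycles (h𝒞 : IsResolving 𝒞) {P : CochainComplex A ℤ} (hP : IsMinusProjective P)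
    (a : ℤ) [P.IsGE a] (n : ℕ) (i j : ℤ) (hij : i + n = j) (hj : j ≤ a) (h : 𝒞 (P.opcycles i)) :
    DimLE 𝒞 n (P.opcycles j) := by
  induction n generalizing j with
  | zero =>
    obtain rfl : i = j := by simpa using hij
    exact h
  | succ n hn =>
    exact ⟨_, opcyclesShortComplex_shortExact (i + n) j (by lia)
      (P.exactAt_of_isGE a _ (by lia)), hn (i + n) rfl (by lia),
      h𝒞.of_projective (hP.projective _), ⟨Iso.refl _⟩⟩

/-- The cokernel of `R₁ ⟶ R₀` for a projective resolution `R` of `X` is `X`. -/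
def opcyclesCochainComplexIso {X : A} (R : ProjectiveResolution X) :
    R.cochainComplex.opcycles 0 ≅ X :=
  haveI := R.cochainComplex.isIso_homologyι 0 1 (by simp)
    ((R.cochainComplex.isZero_of_isStrictlyLE 0 1).eq_of_tgt _ _)
  (asIso (R.cochainComplex.homologyι 0)).symm ≪≫ isoOfQuasiIsoAt R.π' 0 ≪≫
    HomologicalComplex.singleObjHomologySelfIso _ _ _

omit [EnoughProjectives A] in
lemma IsResolving.complexesOf_singleFunctor_zero_of_mem (h𝒞 : IsResolving 𝒞) {X : A} (hX : 𝒞 X) :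
    complexesOf 𝒞 ((singleFunctor A 0).obj X) := by
  refine ⟨(CochainComplex.singleFunctor A 0).obj X, 0, 0, inferInstance, inferInstance,
    fun i => ?_, ⟨(singleFunctorIsoCompQ A 0).app X⟩⟩
  by_cases hi : i = 0
  · subst hi
    exact h𝒞.of_iso (HomologicalComplex.singleObjXSelf (ComplexShape.up ℤ) 0 X).symm hX
  · exact h𝒞.of_isZero (HomologicalComplex.isZero_single_obj_X _ _ _ _ hi)

lemma IsResolving.complexesOf_singleFunctor_zero_iff (h𝒞 : IsResolving 𝒞) (X : A) :
    complexesOf 𝒞 ((singleFunctor A 0).obj X) ↔ ∃ n, DimLE 𝒞 n X := by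
  constructor
  · intro h
    let R := projectiveResolution X
    have hR := isMinusProjective_cochainComplex R
    obtain ⟨a, ha⟩ := exists_opcycles_mem h𝒞 hR ((complexesOf 𝒞).prop_of_iso
      ((singleFunctorIsoCompQ A 0).app X ≪≫ (asIso (Q.map R.π')).symm) h)
    -- The opcycles of `R` in degree `-n` are an `n`-th syzygy of `X`, and lie in `𝒞` once `-n ≤ a`.
    obtain ⟨n, hn⟩ : ∃ n : ℕ, -a ≤ n := ⟨(-a).toNat, by lia⟩
    exact ⟨n, DimLE.of_iso h𝒞 (opcyclesCochainComplexIso R)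
      (dimLE_opcycles h𝒞 hR 0 n (-n) 0 (by simp) (by simp) (ha _ (by lia)))⟩
  · rintro ⟨n, hn⟩
    have := h𝒞.complexesOf_isTriangulated
    induction n generalizing X with
    | zero => exact h𝒞.complexesOf_singleFunctor_zero_of_mem hn
    | succ n hn' =>
      obtain ⟨S, hS, h₁, h₂, ⟨e⟩⟩ := hn
      exact (complexesOf 𝒞).prop_of_iso ((singleFunctor A 0).mapIso e)
        ((complexesOf 𝒞).ext_of_isTriangulatedClosed₃ _ hS.singleTriangle_distinguished
          (hn' _ h₁) (h𝒞.complexesOf_singleFunctor_zero_of_mem h₂))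

lemma IsResolving.complexesOf_Q_obj (h𝒞 : IsResolving 𝒞) (K : CochainComplex A ℤ) (a b : ℤ)
    (ha : K.IsStrictlyGE a) (hb : K.IsStrictlyLE b) (h : ∀ i, ∃ n, DimLE 𝒞 n (K.X i)) :
    complexesOf 𝒞 (Q.obj K) := by
  have := h𝒞.complexesOf_isTriangulated
  refine Q_obj_mem_of_single_mem _ K a b ha hb (fun i => ?_)
  exact (complexesOf 𝒞).prop_of_iso
    (((singleFunctors A).shiftIso (-i) i 0 (by simp)).app (K.X i))
    ((complexesOf 𝒞).le_shift (-i) _ ((h𝒞.complexesOf_singleFunctor_zero_iff _).2 (h i)))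

end

section

open Pretriangulated DerivedCategory

/-! ### Verdier quotients by thick subcategories -/

section

variable {C : Type u} [Category.{v} C] [HasZeroObject C] [HasShift C ℤ] [Preadditive C]
  [∀ n : ℤ, (shiftFunctor C n).Additive] [Pretriangulated C] [IsTriangulated C]

/-- If `X` dies in the quotient, some `s` in `𝒯.trW` with source `X` equalizes `𝟙 X` and `0`, so `s
= 0`. The hypothesis `h𝒯` is thickness in the form needed here: it applies to the triangle on `s`.
-/
lemma prop_of_isZero_Q_obj (𝒯 : ObjectProperty C) [𝒯.IsTriangulated]
    [𝒯.IsClosedUnderIsomorphisms]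
    (h𝒯 : ∀ T ∈ distTriang C, T.mor₁ = 0 → 𝒯 T.obj₃ → 𝒯 T.obj₁) {X : C}
    (hX : IsZero (𝒯.trW.Q.obj X)) : 𝒯 X := by
  obtain ⟨Y, s, hs, fac⟩ := (MorphismProperty.map_eq_iff_postcomp 𝒯.trW.Q 𝒯.trW (𝟙 X) 0).1
    (hX.eq_of_src _ _)
  obtain ⟨Z, g, k, hT⟩ := distinguished_cocone_triangle s
  exact h𝒯 _ hT ((Category.id_comp s).symm.trans (fac.trans zero_comp)) ((𝒯.trW_iff_of_distinguished _ hT).1 hs)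

lemma isIso_Q_map_iff (𝒯 : ObjectProperty C) [𝒯.IsTriangulated] [𝒯.IsClosedUnderIsomorphisms]
    (h𝒯 : ∀ T ∈ distTriang C, T.mor₁ = 0 → 𝒯 T.obj₃ → 𝒯 T.obj₁) {X Y : C} (f : X ⟶ Y) :
    IsIso (𝒯.trW.Q.map f) ↔ 𝒯.trW f := by
  refine ⟨fun hf => ?_, fun hf => Localization.inverts 𝒯.trW.Q 𝒯.trW f hf⟩
  obtain ⟨Z, g, k, hT⟩ := distinguished_cocone_triangle f
  refine (𝒯.trW_iff_of_distinguished _ hT).2 (prop_of_isZero_Q_obj 𝒯 h𝒯 ?_)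
  exact (Triangle.isZero₃_iff_isIso₁ _ (𝒯.trW.Q.map_distinguished _ hT)).2 hf

end

lemma isIso_iff_isIso_app_obj {C : Type*} [Category* C] {D : Type*} [Category* D] {E : Type*}
    [Category* E] (L : C ⥤ D) [L.EssSurj] {F G : D ⥤ E} (τ : F ⟶ G) :
    IsIso τ ↔ ∀ X : C, IsIso (τ.app (L.obj X)) := by
  rw [NatTrans.isIso_iff_isIso_app]
  exact ⟨fun h X => h _, fun h Y => (NatTrans.isIso_app_iff_of_iso τ (L.objObjPreimageIso Y)).1
    (h _)⟩

lemma app_mem_iff_of_iso {C : Type*} [Category* C] {D : Type*} [Category* D]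
    (W : MorphismProperty D) [W.RespectsIso] {F G : C ⥤ D} (τ : F ⟶ G) {X Y : C} (e : X ≅ Y) :
    W (τ.app X) ↔ W (τ.app Y) :=
  W.arrow_mk_iso_iff (Arrow.isoMk (F.mapIso e) (G.mapIso e) (τ.naturality e.hom))

section

variable {A : Type u} [Category.{v} A] [Abelian A] [EnoughProjectives A] [HasDerivedCategory.{w} A]
  {𝒞 : ObjectProperty A}

lemma IsResolving.isIso_Q_map_bounded_iff (h𝒞 : IsResolving 𝒞) {X Y : Bounded A} (f : X ⟶ Y) :
    IsIso ((boundedComplexesOf 𝒞).trW.Q.map f) ↔ (complexesOf 𝒞).trW (Bounded.ι.map f) := by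
  have := h𝒞.complexesOf_isTriangulated
  have : (boundedComplexesOf 𝒞).IsTriangulated :=
    inferInstanceAs ((complexesOf 𝒞).inverseImage Bounded.ι).IsTriangulated
  have : (boundedComplexesOf 𝒞).IsClosedUnderIsomorphisms :=
    inferInstanceAs ((complexesOf 𝒞).inverseImage Bounded.ι).IsClosedUnderIsomorphisms
  refine (isIso_Q_map_iff (boundedComplexesOf 𝒞) (fun T hT zero h => ?_) f).trans
    (ObjectProperty.inverseImage_trW_iff (P := complexesOf 𝒞) (F := Bounded.ι) f)
  exact h𝒞.complexesOf_obj₁_of_mor₁_eq_zero (Bounded.ι.map_distinguished T hT)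
    T.obj₁.property T.obj₂.property ((congrArg Bounded.ι.map zero).trans (Bounded.ι.map_zero _ _)) h

end

/-! ### Units and counits of the localized adjunctions -/

section

variable {A : Type u} [Category.{v} A] [Abelian A] {B : Type u'} [Category.{v'} B] [Abelian B]
  [HasDerivedCategory.{w} A] [HasDerivedCategory.{w'} B]
  {F : A ⥤ B} {G : B ⥤ A} [F.Additive] [G.Additive]
  [PreservesFiniteLimits F] [PreservesFiniteColimits F]
  [PreservesFiniteLimits G] [PreservesFiniteColimits G] (adj : F ⊣ G)

lemma isIso_quotientAdj_unit_app_iff {𝒞 : ObjectProperty A} {𝒟 : ObjectProperty B}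
    (h : 𝒞 ≤ 𝒟.inverseImage F) (h' : 𝒟 ≤ 𝒞.inverseImage G) (X : Bounded A) :
    IsIso ((quotientAdj adj h h').unit.app ((boundedComplexesOf 𝒞).trW.Q.obj X)) ↔
      IsIso ((boundedComplexesOf 𝒞).trW.Q.map ((boundedAdj adj).unit.app X)) := by
  let _ : CatCommSq (boundedMap F) (boundedComplexesOf 𝒞).trW.Q
      (boundedComplexesOf 𝒟).trW.Q (quotientMap F h) := ⟨quotientMapFactors F h⟩
  let _ : CatCommSq (boundedMap G) (boundedComplexesOf 𝒟).trW.Q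
      (boundedComplexesOf 𝒞).trW.Q (quotientMap G h') := ⟨quotientMapFactors G h'⟩
  have H := (boundedAdj adj).localization_unit_app
    (boundedComplexesOf 𝒞).trW.Q (boundedComplexesOf 𝒞).trW
    (boundedComplexesOf 𝒟).trW.Q (boundedComplexesOf 𝒟).trW (quotientMap F h) (quotientMap G h') X
  rw [show (quotientAdj adj h h').unit.app _ = _ from H]
  -- The localized unit is the image of the original one followed by a comparison isomorphism.
  exact isIso_comp_right_iff _ _

lemma isIso_quotientAdj_counit_app_iff {𝒞 : ObjectProperty A} {𝒟 : ObjectProperty B}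
    (h : 𝒞 ≤ 𝒟.inverseImage F) (h' : 𝒟 ≤ 𝒞.inverseImage G) (Y : Bounded B) :
    IsIso ((quotientAdj adj h h').counit.app ((boundedComplexesOf 𝒟).trW.Q.obj Y)) ↔
      IsIso ((boundedComplexesOf 𝒟).trW.Q.map ((boundedAdj adj).counit.app Y)) := by
  let _ : CatCommSq (boundedMap F) (boundedComplexesOf 𝒞).trW.Q
      (boundedComplexesOf 𝒟).trW.Q (quotientMap F h) := ⟨quotientMapFactors F h⟩
  let _ : CatCommSq (boundedMap G) (boundedComplexesOf 𝒟).trW.Q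
      (boundedComplexesOf 𝒞).trW.Q (quotientMap G h') := ⟨quotientMapFactors G h'⟩
  have H := (boundedAdj adj).localization_counit_app
    (boundedComplexesOf 𝒞).trW.Q (boundedComplexesOf 𝒞).trW
    (boundedComplexesOf 𝒟).trW.Q (boundedComplexesOf 𝒟).trW (quotientMap F h) (quotientMap G h') Y
  rw [show (quotientAdj adj h h').counit.app _ = _ from H]
  exact (isIso_comp_left_iff _ _).trans (isIso_comp_left_iff _ _)

lemma ι_map_boundedAdj_unit_app (X : Bounded A) :
    Bounded.ι.map ((boundedAdj adj).unit.app X) = (derivedAdj adj).unit.app X.obj :=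
  ((derivedAdj adj).map_restrictFullyFaithful_unit_app
    (TStructure.t : Triangulated.TStructure (DerivedCategory A)).bounded.fullyFaithfulι
    (TStructure.t : Triangulated.TStructure (DerivedCategory B)).bounded.fullyFaithfulι
    (L := boundedMap F) (R := boundedMap G) (Iso.refl _) (Iso.refl _) X).trans
  ((congrArg (fun k => (derivedAdj adj).unit.app X.obj ≫ k)
    ((Category.comp_id _).trans (CategoryTheory.Functor.map_id
      G.mapDerivedCategory (F.mapDerivedCategory.obj X.obj)))).trans (Category.comp_id _))

lemma ι_map_boundedAdj_counit_app (Y : Bounded B) :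
    Bounded.ι.map ((boundedAdj adj).counit.app Y) = (derivedAdj adj).counit.app Y.obj :=
  ((derivedAdj adj).map_restrictFullyFaithful_counit_app
    (TStructure.t : Triangulated.TStructure (DerivedCategory A)).bounded.fullyFaithfulι
    (TStructure.t : Triangulated.TStructure (DerivedCategory B)).bounded.fullyFaithfulι
    (L := boundedMap F) (R := boundedMap G) (Iso.refl _) (Iso.refl _) Y).trans
  ((Category.id_comp _).trans ((congrArg (· ≫ _) (CategoryTheory.Functor.map_id _ _)).trans
    (Category.id_comp _)))

lemma trW_boundedAdj_unit_app_iff (𝒯 : ObjectProperty (DerivedCategory A)) {X : Bounded A}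
    {K : CochainComplex A ℤ} (e : X.obj ≅ Q.obj K) :
    𝒯.trW (Bounded.ι.map ((boundedAdj adj).unit.app X)) ↔
      𝒯.trW (Q.map ((complexAdj adj).unit.app K)) := by
  let _ : CatCommSq (F.mapHomologicalComplex (ComplexShape.up ℤ)) DerivedCategory.Q
      DerivedCategory.Q F.mapDerivedCategory := ⟨F.mapDerivedCategoryFactors.symm⟩
  let _ : CatCommSq (G.mapHomologicalComplex (ComplexShape.up ℤ)) DerivedCategory.Q
      DerivedCategory.Q G.mapDerivedCategory := ⟨G.mapDerivedCategoryFactors.symm⟩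
  have h₂ := (complexAdj adj).localization_unit_app
    Q (HomologicalComplex.quasiIso A (ComplexShape.up ℤ))
    Q (HomologicalComplex.quasiIso B (ComplexShape.up ℤ))
    F.mapDerivedCategory G.mapDerivedCategory K
  rw [ι_map_boundedAdj_unit_app]
  refine (app_mem_iff_of_iso _ (derivedAdj adj).unit e).trans ?_
  rw [show (derivedAdj adj).unit.app (Q.obj K) = _ from h₂, 𝒯.trW.cancel_right_of_respectsIso]

lemma trW_boundedAdj_counit_app_iff (𝒯 : ObjectProperty (DerivedCategory B)) {Y : Bounded B}
    {K : CochainComplex B ℤ} (e : Y.obj ≅ Q.obj K) :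
    𝒯.trW (Bounded.ι.map ((boundedAdj adj).counit.app Y)) ↔
      𝒯.trW (Q.map ((complexAdj adj).counit.app K)) := by
  let _ : CatCommSq (F.mapHomologicalComplex (ComplexShape.up ℤ)) DerivedCategory.Q
      DerivedCategory.Q F.mapDerivedCategory := ⟨F.mapDerivedCategoryFactors.symm⟩
  let _ : CatCommSq (G.mapHomologicalComplex (ComplexShape.up ℤ)) DerivedCategory.Q
      DerivedCategory.Q G.mapDerivedCategory := ⟨G.mapDerivedCategoryFactors.symm⟩
  have h₂ := (complexAdj adj).localization_counit_app
    Q (HomologicalComplex.quasiIso A (ComplexShape.up ℤ))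
    Q (HomologicalComplex.quasiIso B (ComplexShape.up ℤ))
    F.mapDerivedCategory G.mapDerivedCategory K
  rw [ι_map_boundedAdj_counit_app]
  refine (app_mem_iff_of_iso _ (derivedAdj adj).counit e).trans ?_
  rw [show (derivedAdj adj).counit.app (Q.obj K) = _ from h₂, 𝒯.trW.cancel_left_of_respectsIso,
    𝒯.trW.cancel_left_of_respectsIso]

end

end

/-! ### Termwise cokernels and kernels, and the criterion for Verdier quotients -/

section

open Pretriangulated DerivedCategory

section

variable {A : Type u} [Category.{v} A] [Abelian A]

/-- Cokernels of morphisms of complexes are computed componentwise. -/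
def cokernelXIso {K L : CochainComplex A ℤ} (f : K ⟶ L) (i : ℤ) :
    (cokernel f).X i ≅ cokernel (f.f i) :=
  PreservesCokernel.iso (HomologicalComplex.eval A (ComplexShape.up ℤ) i) f

/-- Kernels of morphisms of complexes are computed componentwise. -/
def kernelXIso {K L : CochainComplex A ℤ} (f : K ⟶ L) (i : ℤ) :
    (kernel f).X i ≅ kernel (f.f i) :=
  PreservesKernel.iso (HomologicalComplex.eval A (ComplexShape.up ℤ) i) f

lemma isStrictlyGE_cokernel {K L : CochainComplex A ℤ} (f : K ⟶ L) (a : ℤ)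
    (hL : L.IsStrictlyGE a) : (cokernel f).IsStrictlyGE a := by
  rw [CochainComplex.isStrictlyGE_iff] at hL ⊢
  exact fun i hi => (IsZero.of_epi (cokernel.π (f.f i)) (hL i hi)).of_iso (cokernelXIso f i)

lemma isStrictlyLE_cokernel {K L : CochainComplex A ℤ} (f : K ⟶ L) (a : ℤ)
    (hL : L.IsStrictlyLE a) : (cokernel f).IsStrictlyLE a := by
  rw [CochainComplex.isStrictlyLE_iff] at hL ⊢
  exact fun i hi => (IsZero.of_epi (cokernel.π (f.f i)) (hL i hi)).of_iso (cokernelXIso f i)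

lemma isStrictlyGE_kernel {K L : CochainComplex A ℤ} (f : K ⟶ L) (a : ℤ)
    (hK : K.IsStrictlyGE a) : (kernel f).IsStrictlyGE a := by
  rw [CochainComplex.isStrictlyGE_iff] at hK ⊢
  exact fun i hi => (IsZero.of_mono (kernel.ι (f.f i)) (hK i hi)).of_iso (kernelXIso f i)

lemma isStrictlyLE_kernel {K L : CochainComplex A ℤ} (f : K ⟶ L) (a : ℤ)
    (hK : K.IsStrictlyLE a) : (kernel f).IsStrictlyLE a := by
  rw [CochainComplex.isStrictlyLE_iff] at hK ⊢
  exact fun i hi => (IsZero.of_mono (kernel.ι (f.f i)) (hK i hi)).of_iso (kernelXIso f i)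

variable [HasDerivedCategory.{w} A]

lemma trW_Q_map_iff_cokernel (𝒯 : ObjectProperty (DerivedCategory A))
    [𝒯.IsClosedUnderIsomorphisms] {K L : CochainComplex A ℤ} (f : K ⟶ L) [Mono f] :
    𝒯.trW (Q.map f) ↔ 𝒯 (Q.obj (cokernel f)) :=
  𝒯.trW_iff_of_distinguished _ (triangleOfSES_distinguished (shortExact_cokernel f))

/-- Here the kernel is the cone only up to a shift, hence the stability assumption. -/
lemma trW_Q_map_iff_kernel (𝒯 : ObjectProperty (DerivedCategory A))
    [𝒯.IsClosedUnderIsomorphisms] [𝒯.IsStableUnderShift ℤ] {K L : CochainComplex A ℤ}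
    (f : K ⟶ L) [Epi f] : 𝒯.trW (Q.map f) ↔ 𝒯 (Q.obj (kernel f)) :=
  𝒯.trW_iff_of_distinguished' _ (triangleOfSES_distinguished (shortExact_kernel f))

variable [EnoughProjectives A] {𝒞 : ObjectProperty A}

lemma IsResolving.exists_dimLE_X_zero (h𝒞 : IsResolving 𝒞) (K : CochainComplex A ℤ)
    (hK : K.IsStrictlyGE 0) (hK' : K.IsStrictlyLE 0) (h : complexesOf 𝒞 (Q.obj K)) :
    ∃ n, DimLE 𝒞 n (K.X 0) := by
  obtain ⟨M, ⟨e⟩⟩ := K.exists_iso_single 0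
  obtain ⟨n, hn⟩ := (h𝒞.complexesOf_singleFunctor_zero_iff M).1
    ((complexesOf 𝒞).prop_of_iso (Q.mapIso e ≪≫ ((singleFunctorIsoCompQ A 0).app M).symm) h)
  exact ⟨n, hn.of_iso h𝒞 ((HomologicalComplex.eval A (ComplexShape.up ℤ) 0).mapIso e ≪≫
    HomologicalComplex.singleObjXSelf (ComplexShape.up ℤ) 0 M).symm⟩

omit [EnoughProjectives A] in
lemma bounded_Q_obj (K : CochainComplex A ℤ) (a b : ℤ) (ha : K.IsStrictlyGE a)
    (hb : K.IsStrictlyLE b) :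
    (TStructure.t : Triangulated.TStructure (DerivedCategory A)).bounded (Q.obj K) :=
  ⟨⟨a, inferInstance⟩, ⟨b, inferInstance⟩⟩

end

section

variable {A : Type u} [Category.{v} A] [Abelian A] [EnoughProjectives A]
  {B : Type u'} [Category.{v'} B] [Abelian B] [EnoughProjectives B]
  [HasDerivedCategory.{w} A] [HasDerivedCategory.{w'} B]
  {F : A ⥤ B} {G : B ⥤ A} [F.Additive] [G.Additive]
  [PreservesFiniteLimits F] [PreservesFiniteColimits F]
  [PreservesFiniteLimits G] [PreservesFiniteColimits G] (adj : F ⊣ G)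
  {𝒞 : ObjectProperty A} {𝒟 : ObjectProperty B}

-- The unit on complexes is a termwise monomorphism, so its cone is the termwise cokernel. Stalk
-- complexes in degree `0` give the forward direction; devissage over the terms of a bounded complex
-- gives the converse.
omit [EnoughProjectives B] in
lemma isIso_quotientAdj_unit_iff [F.Faithful] (h𝒞 : IsResolving 𝒞)
    (h : 𝒞 ≤ 𝒟.inverseImage F) (h' : 𝒟 ≤ 𝒞.inverseImage G) :
    IsIso (quotientAdj adj h h').unit ↔
      ∀ X : A, ∃ n, DimLE 𝒞 n (cokernel (adj.unit.app X)) := by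
  have : (boundedComplexesOf 𝒞).trW.Q.EssSurj := Localization.essSurj _ (boundedComplexesOf 𝒞).trW
  have hmono (K : CochainComplex A ℤ) : Mono ((complexAdj adj).unit.app K) :=
    HomologicalComplex.mono_of_mono_f _ (fun i => adj.unit_mono_of_L_faithful (K.X i))
  simp only [isIso_iff_isIso_app_obj (boundedComplexesOf 𝒞).trW.Q,
    isIso_quotientAdj_unit_app_iff, h𝒞.isIso_Q_map_bounded_iff]
  constructor
  · intro H X
    have hX := bounded_Q_obj ((CochainComplex.singleFunctor A 0).obj X) 0 0 inferInstance
      inferInstance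
    have H' := (trW_Q_map_iff_cokernel _ _).1
      ((trW_boundedAdj_unit_app_iff adj (complexesOf 𝒞) (Iso.refl _)).1 (H ⟨_, hX⟩))
    obtain ⟨n, hn⟩ := h𝒞.exists_dimLE_X_zero _
      (isStrictlyGE_cokernel _ _ (isStrictlyGE_map G _ _ (isStrictlyGE_map F _ _ inferInstance)))
      (isStrictlyLE_cokernel _ _ (isStrictlyLE_map G _ _ (isStrictlyLE_map F _ _ inferInstance))) H'
    let e := HomologicalComplex.singleObjXSelf (ComplexShape.up ℤ) 0 X
    exact ⟨n, hn.of_iso h𝒞 (cokernelXIso _ 0 ≪≫ cokernel.mapIso _ _ e ((F ⋙ G).mapIso e)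
      (adj.unit.naturality e.hom).symm)⟩
  · intro H X
    obtain ⟨⟨a, ha⟩, ⟨b, hb⟩⟩ := X.property
    obtain ⟨K, hK, hK', ⟨e⟩⟩ := exists_iso_Q_obj_of_isGE_of_isLE X.obj a b
    refine (trW_boundedAdj_unit_app_iff adj _ e).2 ((trW_Q_map_iff_cokernel _ _).2
      (h𝒞.complexesOf_Q_obj _ a b
        (isStrictlyGE_cokernel _ _ (isStrictlyGE_map G _ _ (isStrictlyGE_map F _ _ hK)))
        (isStrictlyLE_cokernel _ _ (isStrictlyLE_map G _ _ (isStrictlyLE_map F _ _ hK')))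
        (fun i => ?_)))
    obtain ⟨n, hn⟩ := H (K.X i)
    exact ⟨n, hn.of_iso h𝒞 (cokernelXIso ((complexAdj adj).unit.app K) i).symm⟩

omit [EnoughProjectives A] in
lemma isIso_quotientAdj_counit_iff [G.Faithful] (h𝒟 : IsResolving 𝒟)
    (h : 𝒞 ≤ 𝒟.inverseImage F) (h' : 𝒟 ≤ 𝒞.inverseImage G) :
    IsIso (quotientAdj adj h h').counit ↔
      ∀ Y : B, ∃ n, DimLE 𝒟 n (kernel (adj.counit.app Y)) := by
  have : (boundedComplexesOf 𝒟).trW.Q.EssSurj := Localization.essSurj _ (boundedComplexesOf 𝒟).trW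
  have hepi (K : CochainComplex B ℤ) : Epi ((complexAdj adj).counit.app K) :=
    HomologicalComplex.epi_of_epi_f _ (fun i => adj.counit_epi_of_R_faithful (K.X i))
  simp only [isIso_iff_isIso_app_obj (boundedComplexesOf 𝒟).trW.Q,
    isIso_quotientAdj_counit_app_iff, h𝒟.isIso_Q_map_bounded_iff]
  constructor
  · intro H Y
    have hY := bounded_Q_obj ((CochainComplex.singleFunctor B 0).obj Y) 0 0 inferInstance
      inferInstance
    have H' := (trW_Q_map_iff_kernel _ _).1
      ((trW_boundedAdj_counit_app_iff adj (complexesOf 𝒟) (Iso.refl _)).1 (H ⟨_, hY⟩))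
    obtain ⟨n, hn⟩ := h𝒟.exists_dimLE_X_zero _
      (isStrictlyGE_kernel _ _ (isStrictlyGE_map F _ _ (isStrictlyGE_map G _ _ inferInstance)))
      (isStrictlyLE_kernel _ _ (isStrictlyLE_map F _ _ (isStrictlyLE_map G _ _ inferInstance))) H'
    let e := HomologicalComplex.singleObjXSelf (ComplexShape.up ℤ) 0 Y
    exact ⟨n, hn.of_iso h𝒟 (kernelXIso _ 0 ≪≫ kernel.mapIso _ _ ((G ⋙ F).mapIso e) e
      (adj.counit.naturality e.hom).symm)⟩
  · intro H Y
    obtain ⟨⟨a, ha⟩, ⟨b, hb⟩⟩ := Y.property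
    obtain ⟨K, hK, hK', ⟨e⟩⟩ := exists_iso_Q_obj_of_isGE_of_isLE Y.obj a b
    refine (trW_boundedAdj_counit_app_iff adj _ e).2 ((trW_Q_map_iff_kernel _ _).2
      (h𝒟.complexesOf_Q_obj _ a b
        (isStrictlyGE_kernel _ _ (isStrictlyGE_map F _ _ (isStrictlyGE_map G _ _ hK)))
        (isStrictlyLE_kernel _ _ (isStrictlyLE_map F _ _ (isStrictlyLE_map G _ _ hK')))
        (fun i => ?_)))
    obtain ⟨n, hn⟩ := H (K.X i)
    exact ⟨n, hn.of_iso h𝒟 (kernelXIso ((complexAdj adj).counit.app K) i).symm⟩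

end

end

end FrobGor

end

open FrobGor

theorem proposition4p2 {A : Type u} [Category.{v} A] [Abelian A] [EnoughProjectives A]
    {B : Type u'} [Category.{v'} B] [Abelian B] [EnoughProjectives B]
    [HasDerivedCategory.{w} A] [HasDerivedCategory.{w'} B]
    (F : A ⥤ B) (G : B ⥤ A) [F.Additive] [G.Additive] [F.Faithful] [G.Faithful]
    (h : FrobeniusPair F G) :
    (YieldsEquivalences h.stableAdjunction ↔
      (∀ X : A, gorensteinProjective A X →
        projectiveDimension (cokernel (h.adj.unit.app X)) ≤ 1) ∧
      (∀ Y : B, gorensteinProjective B Y → Projective (kernel (h.adj.counit.app Y)))) ∧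
    (YieldsEquivalences (h.sgAdjunction : (h.sgLeft : Dsg A ⥤ Dsg B) ⊣ h.sgRight) ↔
      (∀ X : A, projectiveDimension (cokernel (h.adj.unit.app X)) ≠ ⊤) ∧
      (∀ Y : B, projectiveDimension (kernel (h.adj.counit.app Y)) ≠ ⊤)) ∧
    (YieldsEquivalences (h.defAdjunction : (h.defLeft : Ddef A ⥤ Ddef B) ⊣ h.defRight) ↔
      (∀ X : A, HasFiniteGpd (cokernel (h.adj.unit.app X))) ∧
      (∀ Y : B, HasFiniteGpd (kernel (h.adj.counit.app Y)))) := by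
  have := h.preservesFiniteLimits_left
  have := h.preservesFiniteColimits_left
  have := h.preservesFiniteLimits_right
  have := h.preservesFiniteColimits_right
  refine ⟨yieldsEquivalences_stableAdj_iff h.adj _ _ _ _, ?_, ?_⟩
  -- The last two parts are the same criterion, for the resolving classes of projective and of
  -- Gorenstein projective objects.
  · simp only [projectiveDimension_ne_top_iff, hasProjectiveDimensionLE_iff_dimLE]
    exact and_congr
      (isIso_quotientAdj_unit_iff h.adj isResolving_isProjective h.projective_left
        h.projective_right)
      (isIso_quotientAdj_counit_iff h.adj isResolving_isProjective h.projective_left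
        h.projective_right)
  · simp only [HasFiniteGpd, gpdLE_iff_dimLE]
    exact and_congr
      (isIso_quotientAdj_unit_iff h.adj isResolving_gorensteinProjective
        h.gorensteinProjective_left h.gorensteinProjective_right)
      (isIso_quotientAdj_counit_iff h.adj isResolving_gorensteinProjective
        h.gorensteinProjective_left h.gorensteinProjective_right)
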